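/- Conventions. All groupoids $G$ are locally compact Hausdorff topological groupoids, with unit space $G^{0}$, range and source maps $r,s$, and a (left) Haar system. A continuous family of measures along a continuous map $p\colon X\to U$ is a family $\{\lambda_u\}_{u\in U}$ of Radon measures on $X$, $\lambda_u$ concentrated on $p^{-1}(u)$, such that $u\mapsto\int f\,d\lambda_u$ is continuous for all $f\in C_c(X)$. A topological correspondence $(X,\lambda)$ from $(G,\alpha)$ to $(H,\beta)$ is a locally compact Hausdorff space $X$ with commuting continuous actions of $G$ (left, momentum map $r_X$) and $H$ (right, momentum map $s_X$), the action of $H$ being proper, with an $H$-invariant continuous family of measures $\lambda=\{\lambda_u\}_{u\in H^0}$ along $s_X$, and with a continuous function $\Delta\colon G\ltimes X\to(0,\infty)$ (the adjoining function) such that for all $u\in H^0$ and $F\in C_c(G\times_{G^0}X)$ $$\iint F(\gamma^{-1},x)\,d\alpha^{r_X(x)}(\gamma)\,d\lambda_u(x)=\iint F(\gamma,\gamma^{-1}x)\,\Delta(\gamma,\gamma^{-1}x)\,d\alpha^{r_X(x)}(\gamma)\,d\lambda_u(x).$$ Two families of measures $\lambda,\lambda'$ along the same map are equivalent if $\lambda_u,\lambda'_u$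 are mutually absolutely continuous for each $u$ and the Radon--Nikodym derivatives $d\lambda_u/d\lambda'_u$ are given by one positive continuous function on $X$. An isomorphism $(X,\lambda)\to(X',\lambda')$ of topological correspondences from $(G,\alpha)$ to $(H,\beta)$ is a $G$-$H$-equivariant homeomorphism $\phi\colon X\to X'$ such that $\phi_*\lambda$ and $\lambda'$ are equivalent. Let $(X,\alpha)\colon(G_1,\chi_1)\to(G_2,\chi_2)$ and $(Y,\beta)\colon(G_2,\chi_2)\to(G_3,\chi_3)$ be topological correspondences, with adjoining functions $\Delta_1$ and $\Delta_2$. Let $Z=X\times_{G_2^0}Y$ with the diagonal action $(x,y)\gamma=(x\gamma,\gamma^{-1}y)$ of $G_2$, let $\Omega=Z/G_2$ with the induced actions $\eta[x,y]=[\eta x,y]$ of $G_1$ and $[x,y]\eta=[x,y\eta]$ of $G_3$, let $\pi\colon Z\to\Omega$ be the quotient map, and assume that $\Omega$ is paracompact. A composite of $(X,\alpha)$ and $(Y,\beta)$ obtained by using a $0$-cochain $b$ is a pair $(\Omega,\mu)$ where $b\colon Z\to(0,\infty)$ is continuous and $G_3$-invariant and satisfies $b(x\gamma,\gamma^{-1}y)/b(x,y)=\Delta_2(\gamma^{-1},y)$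 for all $((x,y),\gamma)\in Z\rtimes G_2$, and where $\mu=\{\mu_u\}_{u\in G_3^0}$ is a family of Radon measures on $\Omega$ that lifts to $\{b\,(\alpha\times\beta_u)\}_u$, that is, for all $u\in G_3^0$ and $F\in C_c(Z)$ $$\int_\Omega\int_{G_2}F(x\gamma,\gamma^{-1}y)\,d\chi_2^{r_Y(y)}(\gamma)\,d\mu_u([x,y])=\int_Y\int_X F(x,y)\,b(x,y)\,d\alpha_{r_Y(y)}(x)\,d\beta_u(y).$$ Proposition. Let $(\Omega,\mu)$ and $(\Omega,\mu')$ be composites of $(X,\alpha)$ and $(Y,\beta)$ obtained by using $0$-cochains $b$ and $b'$, respectively. Then $(\Omega,\mu)$ and $(\Omega,\mu')$ are topological correspondences from $(G_1,\chi_1)$ to $(G_3,\chi_3)$, and the identity map of $\Omega$ is an isomorphism between them. Moreover, there is a unique function $c\colon\Omega\to\mathbb R$ with $b'=(c\circ\pi)\,b$; it is continuous and positive, and $\dfrac{d\mu'_u}{d\mu_u}=c$, i.e. $\mu'_u=c\,\mu_u$, for every $u\in G_3^0$. -/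

import Mathlib

open MeasureTheory Topology
open scoped CompactlySupported

noncomputable section

/-- A topological groupoid with space of arrows `G` and space of units `U`.  The product `mul a b` is
defined exactly when `s a = r b`.  (The unit map `one` is automatically an embedding of `U` into
`G`, as it has the continuous left inverse `r`.) -/
structure TopGroupoid (G U : Type*) [TopologicalSpace G] [TopologicalSpace U] where
  r : G → U
  s : G → U
  one : U → G
  inv : G → G
  mul : ∀ a b : G, s a = r b → G
  r_one : ∀ u, r (one u) = u
  s_one : ∀ u, s (one u) = u
  r_inv : ∀ a, r (inv a) = s a
  s_inv : ∀ a, s (inv a) = r a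
  r_mul : ∀ a b h, r (mul a b h) = r a
  s_mul : ∀ a b h, s (mul a b h) = s b
  one_mul : ∀ a, mul (one (r a)) a (s_one (r a)) = a
  mul_one : ∀ a, mul a (one (s a)) (r_one (s a)).symm = a
  inv_mul : ∀ a, mul (inv a) a (s_inv a) = one (s a)
  mul_inv : ∀ a, mul a (inv a) (r_inv a).symm = one (r a)
  mul_assoc : ∀ a b c (hab : s a = r b) (hbc : s b = r c),
    mul (mul a b hab) c ((s_mul a b hab).trans hbc) =
      mul a (mul b c hbc) (hab.trans (r_mul b c hbc).symm)
  continuous_r : Continuous r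
  continuous_s : Continuous s
  continuous_one : Continuous one
  continuous_inv : Continuous inv
  continuous_mul : Continuous fun p : {p : G × G // s p.1 = r p.2} => mul p.1.1 p.1.2 p.2

namespace TopGroupoid

variable {G U : Type*} [TopologicalSpace G] [TopologicalSpace U] (𝓖 : TopGroupoid G U)

theorem mul_congr {a a' b b' : G} (ha : a = a') (hb : b = b') (h : 𝓖.s a = 𝓖.r b)
    (h' : 𝓖.s a' = 𝓖.r b') : 𝓖.mul a b h = 𝓖.mul a' b' h' := by
  subst ha hb; rfl

theorem one_mul' {u : U} {a : G} (h : 𝓖.s (𝓖.one u) = 𝓖.r a) : 𝓖.mul (𝓖.one u) a h = a := by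
  have hu : u = 𝓖.r a := (𝓖.s_one u).symm.trans h
  subst hu; exact 𝓖.one_mul a

theorem mul_one' {u : U} {a : G} (h : 𝓖.s a = 𝓖.r (𝓖.one u)) : 𝓖.mul a (𝓖.one u) h = a := by
  have hu : 𝓖.s a = u := h.trans (𝓖.r_one u)
  subst hu; exact 𝓖.mul_one a

theorem eq_inv {a b : G} (h : 𝓖.s b = 𝓖.r a) (hb : 𝓖.mul b a h = 𝓖.one (𝓖.s a)) :
    b = 𝓖.inv a := by
  have h1 := 𝓖.mul_assoc b a (𝓖.inv a) h (𝓖.r_inv a).symm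
  rw [𝓖.mul_congr hb rfl _ ((𝓖.s_one _).trans (𝓖.r_inv a).symm), 𝓖.one_mul',
    𝓖.mul_congr rfl (𝓖.mul_inv a) _ (h.trans (𝓖.r_one _).symm), 𝓖.mul_one'] at h1
  exact h1.symm

theorem inv_one (u : U) : 𝓖.inv (𝓖.one u) = 𝓖.one u := by
  refine (𝓖.eq_inv ((𝓖.s_one u).trans (𝓖.r_one u).symm) ?_).symm
  rw [𝓖.one_mul', 𝓖.s_one]

theorem inv_mul_rev (a b : G) (h : 𝓖.s a = 𝓖.r b) :
    𝓖.inv (𝓖.mul a b h) = 𝓖.mul (𝓖.inv b) (𝓖.inv a)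
      ((𝓖.s_inv b).trans (h.symm.trans (𝓖.r_inv a).symm)) := by
  have hab : 𝓖.s (𝓖.inv b) = 𝓖.r (𝓖.inv a) := (𝓖.s_inv b).trans (h.symm.trans (𝓖.r_inv a).symm)
  have key : 𝓖.mul (𝓖.inv a) (𝓖.mul a b h) ((𝓖.s_inv a).trans (𝓖.r_mul a b h).symm) = b := by
    rw [← 𝓖.mul_assoc (𝓖.inv a) a b (𝓖.s_inv a) h,
      𝓖.mul_congr (𝓖.inv_mul a) rfl _ ((𝓖.s_one _).trans h), 𝓖.one_mul']
  refine (𝓖.eq_inv ((𝓖.s_mul _ _ _).trans ((𝓖.s_inv a).trans (𝓖.r_mul a b h).symm)) ?_).symm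
  rw [𝓖.mul_assoc (𝓖.inv b) (𝓖.inv a) (𝓖.mul a b h) hab
    ((𝓖.s_inv a).trans (𝓖.r_mul a b h).symm), 𝓖.mul_congr rfl key _ (𝓖.s_inv b), 𝓖.inv_mul,
    𝓖.s_mul]

end TopGroupoid

/-- A continuous family of Radon measures along a map `p : X → U`: each `lam u` is a Radon
measure concentrated on the fibre over `u`, and `u ↦ ∫ f d(lam u)` is continuous for every
continuous compactly supported `f`. -/
structure IsContinuousFamily {X U : Type*} [TopologicalSpace X] [MeasurableSpace X]
    [TopologicalSpace U] (p : X → U) (lam : U → Measure X) : Prop where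
  regular : ∀ u, (lam u).Regular
  concentrated : ∀ u, lam u (p ⁻¹' {u})ᶜ = 0
  continuous_integral : ∀ f : C_c(X, ℝ), Continuous fun u => ∫ x, f x ∂(lam u)

/-- A topological groupoid with a (left) Haar system. -/
structure HaarGroupoid (G U : Type*) [TopologicalSpace G] [TopologicalSpace U]
    [MeasurableSpace G] extends TopGroupoid G U where
  haar : U → Measure G
  haar_family : IsContinuousFamily r haar
  /-- the support of `haar u` is the whole fibre of `r` over `u` -/
  haar_full : ∀ (u : U) (V : Set G), IsOpen V → (V ∩ r ⁻¹' {u}).Nonempty → 0 < haar u V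
  /-- left invariance; the integrand matters only on the fibre of `r` over `s g` -/
  haar_invariant : ∀ (g : G) (f : C_c(G, ℝ)),
    ∫ x, (open Classical in if h : s g = r x then f (mul g x h) else 0) ∂(haar (s g)) =
      ∫ x, f x ∂(haar (r g))

section Actions

variable {G U H V X : Type*} [TopologicalSpace G] [TopologicalSpace U] [TopologicalSpace H]
  [TopologicalSpace V]

/-- A left action of a groupoid on a set `X` with momentum map `mom` (continuity is a separate
predicate). -/
structure LeftAction (𝓖 : TopGroupoid G U) (X : Type*) where
  mom : X → U
  act : ∀ (g : G) (x : X), 𝓖.s g = mom x → X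
  mom_act : ∀ g x h, mom (act g x h) = 𝓖.r g
  one_act : ∀ x, act (𝓖.one (mom x)) x (𝓖.s_one _) = x
  mul_act : ∀ a b x (hab : 𝓖.s a = 𝓖.r b) (h : 𝓖.s b = mom x),
    act (𝓖.mul a b hab) x ((𝓖.s_mul a b hab).trans h) =
      act a (act b x h) (hab.trans (mom_act b x h).symm)

/-- A right action of a groupoid on a set `X` with momentum map `mom`. -/
structure RightAction (𝓗 : TopGroupoid H V) (X : Type*) where
  mom : X → V
  act : ∀ (x : X) (g : H), mom x = 𝓗.r g → X
  mom_act : ∀ x g h, mom (act x g h) = 𝓗.s g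
  act_one : ∀ x, act x (𝓗.one (mom x)) (𝓗.r_one _).symm = x
  act_mul : ∀ x a b (h : mom x = 𝓗.r a) (hab : 𝓗.s a = 𝓗.r b),
    act x (𝓗.mul a b hab) (h.trans (𝓗.r_mul a b hab).symm) =
      act (act x a h) b ((mom_act x a h).trans hab)

theorem LeftAction.act_congr {𝓖 : TopGroupoid G U} (L : LeftAction 𝓖 X) {g g' : G} {x x' : X}
    (hg : g = g') (hx : x = x') (h : 𝓖.s g = L.mom x) (h' : 𝓖.s g' = L.mom x') :
    L.act g x h = L.act g' x' h' := by
  subst hg hx; rfl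

theorem LeftAction.act_of_eq_one {𝓖 : TopGroupoid G U} (L : LeftAction 𝓖 X) {g : G} {x : X} {u : U}
    (hg : g = 𝓖.one u) (h : 𝓖.s g = L.mom x) : L.act g x h = x := by
  subst hg
  have hu : u = L.mom x := (𝓖.s_one u).symm.trans h
  subst hu; exact L.one_act x

theorem RightAction.act_congr {𝓗 : TopGroupoid H V} (R : RightAction 𝓗 X) {g g' : H} {x x' : X}
    (hx : x = x') (hg : g = g') (h : R.mom x = 𝓗.r g) (h' : R.mom x' = 𝓗.r g') :
    R.act x g h = R.act x' g' h' := by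
  subst hg hx; rfl

theorem RightAction.act_of_eq_one {𝓗 : TopGroupoid H V} (R : RightAction 𝓗 X) {g : H} {x : X}
    {u : V} (hg : g = 𝓗.one u) (h : R.mom x = 𝓗.r g) : R.act x g h = x := by
  subst hg
  have hu : R.mom x = u := h.trans (𝓗.r_one u)
  subst hu; exact R.act_one x

/-- The arrow space of the transformation groupoid `𝓖 ⋉ X` of a left action. -/
abbrev LeftAction.Trans {𝓖 : TopGroupoid G U} (L : LeftAction 𝓖 X) : Type _ :=
  {p : G × X // 𝓖.s p.1 = L.mom p.2}

/-- The arrow space of the transformation groupoid `X ⋊ 𝓗` of a right action. -/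
abbrev RightAction.Trans {𝓗 : TopGroupoid H V} (R : RightAction 𝓗 X) : Type _ :=
  {p : X × H // R.mom p.1 = 𝓗.r p.2}

structure LeftAction.IsContinuous [TopologicalSpace X] {𝓖 : TopGroupoid G U}
    (L : LeftAction 𝓖 X) : Prop where
  mom : Continuous L.mom
  act : Continuous fun p : L.Trans => L.act p.1.1 p.1.2 p.2

structure RightAction.IsContinuous [TopologicalSpace X] {𝓗 : TopGroupoid H V}
    (R : RightAction 𝓗 X) : Prop where
  mom : Continuous R.mom
  act : Continuous fun p : R.Trans => R.act p.1.1 p.1.2 p.2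

/-- A right action is proper if `(x, η) ↦ (x, x η)` is a proper map `X ⋊ 𝓗 → X × X`. -/
def RightAction.IsProper [TopologicalSpace X] {𝓗 : TopGroupoid H V}
    (R : RightAction 𝓗 X) : Prop :=
  IsProperMap fun p : R.Trans => ((p.1.1, R.act p.1.1 p.1.2 p.2) : X × X)

/-- A family of measures along the momentum map of a right action is invariant if
`∫ f(xη) dlam_{r(η)}(x) = ∫ f(x) dlam_{s(η)}(x)`. -/
def RightAction.IsInvariantFamily [TopologicalSpace X] [MeasurableSpace X]
    {𝓗 : TopGroupoid H V} (R : RightAction 𝓗 X) (lam : V → Measure X) : Prop :=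
  ∀ (g : H) (f : C_c(X, ℝ)),
    ∫ x, (open Classical in if h : R.mom x = 𝓗.r g then f (R.act x g h) else 0) ∂(lam (𝓗.r g)) =
      ∫ x, f x ∂(lam (𝓗.s g))

/-- Commuting left and right actions. -/
structure Bispace (𝓖 : TopGroupoid G U) (𝓗 : TopGroupoid H V) (X : Type*) where
  left : LeftAction 𝓖 X
  right : RightAction 𝓗 X
  left_mom_act : ∀ x g h, left.mom (right.act x g h) = left.mom x
  right_mom_act : ∀ g x h, right.mom (left.act g x h) = right.mom x
  act_comm : ∀ a x g (h : 𝓖.s a = left.mom x) (h' : right.mom x = 𝓗.r g),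
    right.act (left.act a x h) g ((right_mom_act a x h).trans h') =
      left.act a (right.act x g h') (h.trans (left_mom_act x g h').symm)

/-- The point `(γ⁻¹, x)` of `𝓖 ⋉ X`, for `γ` in the `r`-fibre over the momentum of `x`. -/
def LeftAction.invPt {𝓖 : TopGroupoid G U} (L : LeftAction 𝓖 X) (g : G) (x : X)
    (h : 𝓖.r g = L.mom x) : L.Trans :=
  ⟨(𝓖.inv g, x), (𝓖.s_inv g).trans h⟩

/-- The point `(γ, γ⁻¹x)` of `𝓖 ⋉ X`, for `γ` in the `r`-fibre over the momentum of `x`. -/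
def LeftAction.movePt {𝓖 : TopGroupoid G U} (L : LeftAction 𝓖 X) (g : G) (x : X)
    (h : 𝓖.r g = L.mom x) : L.Trans :=
  ⟨(g, L.act (𝓖.inv g) x ((𝓖.s_inv g).trans h)),
    ((L.mom_act _ _ _).trans (𝓖.r_inv g)).symm⟩

/-- `Δ` is an adjoining function for the family `lam`: a positive continuous function on `𝓖 ⋉ X`
with
`∫∫ F(γ⁻¹,x) dα^{r(x)}(γ) dlam_u(x) = ∫∫ F(γ,γ⁻¹x) Δ(γ,γ⁻¹x) dα^{r(x)}(γ) dlam_u(x)`. -/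
structure IsAdjoining [TopologicalSpace X] [MeasurableSpace G] [MeasurableSpace X]
    (𝓖 : HaarGroupoid G U) (L : LeftAction 𝓖.toTopGroupoid X) (lam : V → Measure X)
    (Δ : L.Trans → ℝ) : Prop where
  continuous : Continuous Δ
  pos : ∀ p, 0 < Δ p
  integral_eq : ∀ (u : V) (F : C_c(L.Trans, ℝ)),
    ∫ x, ∫ g, (open Classical in if h : 𝓖.r g = L.mom x then F (L.invPt g x h) else 0)
        ∂(𝓖.haar (L.mom x)) ∂(lam u) =
      ∫ x, ∫ g, (open Classical in if h : 𝓖.r g = L.mom x then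
          F (L.movePt g x h) * Δ (L.movePt g x h) else 0)
        ∂(𝓖.haar (L.mom x)) ∂(lam u)

/-- A topological correspondence from `𝓖` to `𝓗` with underlying (locally compact Hausdorff) space
`X`, family of measures `lam` and adjoining function `adj`. -/
structure TopologicalCorrespondence [MeasurableSpace G] [MeasurableSpace H]
    (𝓖 : HaarGroupoid G U) (𝓗 : HaarGroupoid H V) (X : Type*) [TopologicalSpace X]
    [MeasurableSpace X] extends Bispace 𝓖.toTopGroupoid 𝓗.toTopGroupoid X where
  t2 : T2Space X
  locallyCompact : LocallyCompactSpace X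
  left_continuous : left.IsContinuous
  right_continuous : right.IsContinuous
  right_proper : right.IsProper
  lam : V → Measure X
  family : IsContinuousFamily right.mom lam
  invariant : right.IsInvariantFamily lam
  adj : left.Trans → ℝ
  adjoining : IsAdjoining 𝓖 left lam adj

end Actions

/-- The function `g` is a Radon–Nikodym derivative `d lam / d lam'` of families of measures. -/
def IsRNDeriv {X V : Type*} [MeasurableSpace X] (lam lam' : V → Measure X) (g : X → ℝ) : Prop :=
  ∀ v, lam v = (lam' v).withDensity fun x => ENNReal.ofReal (g x)

/-- Equivalence of families of measures: the members are fibrewise mutually absolutely continuous,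
and the Radon–Nikodym derivative is a positive continuous function on the total space. -/
def EquivalentFamilies {X V : Type*} [TopologicalSpace X] [MeasurableSpace X]
    (lam lam' : V → Measure X) : Prop :=
  (∀ v, lam v ≪ lam' v ∧ lam' v ≪ lam v) ∧
    ∃ g : X → ℝ, Continuous g ∧ (∀ x, 0 < g x) ∧ IsRNDeriv lam lam' g

/-- The homeomorphism `φ` is an isomorphism of topological correspondences: it is equivariant for
both actions and the push-forward of the first family is equivalent to the second family. -/
structure IsCorrIso {G U H V X X' : Type*} [TopologicalSpace G] [TopologicalSpace U]
    [TopologicalSpace H] [TopologicalSpace V] [TopologicalSpace X] [TopologicalSpace X']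
    [MeasurableSpace G] [MeasurableSpace H] [MeasurableSpace X] [MeasurableSpace X']
    {𝓖 : HaarGroupoid G U} {𝓗 : HaarGroupoid H V}
    (M : TopologicalCorrespondence 𝓖 𝓗 X) (M' : TopologicalCorrespondence 𝓖 𝓗 X')
    (φ : X ≃ₜ X') : Prop where
  left_mom : ∀ x, M'.left.mom (φ x) = M.left.mom x
  right_mom : ∀ x, M'.right.mom (φ x) = M.right.mom x
  left_act : ∀ g x (h : 𝓖.s g = M.left.mom x),
    φ (M.left.act g x h) = M'.left.act g (φ x) (h.trans (left_mom x).symm)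
  right_act : ∀ x g (h : M.right.mom x = 𝓗.r g),
    φ (M.right.act x g h) = M'.right.act (φ x) g ((right_mom x).trans h)
  equivalent : EquivalentFamilies (fun v => (M.lam v).map φ) M'.lam

section Composite

variable {G₁ U₁ G₂ U₂ G₃ U₃ X Y : Type*}
  [TopologicalSpace G₁] [TopologicalSpace U₁] [TopologicalSpace G₂] [TopologicalSpace U₂]
  [TopologicalSpace G₃] [TopologicalSpace U₃]
  {𝓖₁ : TopGroupoid G₁ U₁} {𝓖₂ : TopGroupoid G₂ U₂} {𝓖₃ : TopGroupoid G₃ U₃}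

/-- The fibre product `Z = X ×_{U₂} Y`. -/
def FibreProd (A : Bispace 𝓖₁ 𝓖₂ X) (B : Bispace 𝓖₂ 𝓖₃ Y) : Type _ :=
  {p : X × Y // A.right.mom p.1 = B.left.mom p.2}

instance [TopologicalSpace X] [TopologicalSpace Y] (A : Bispace 𝓖₁ 𝓖₂ X)
    (B : Bispace 𝓖₂ 𝓖₃ Y) : TopologicalSpace (FibreProd A B) :=
  inferInstanceAs (TopologicalSpace {p : X × Y // A.right.mom p.1 = B.left.mom p.2})

namespace FibreProd

variable {A : Bispace 𝓖₁ 𝓖₂ X} {B : Bispace 𝓖₂ 𝓖₃ Y}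

def fst (z : FibreProd A B) : X := z.1.1

def snd (z : FibreProd A B) : Y := z.1.2

theorem ext' {z w : FibreProd A B} (h₁ : z.fst = w.fst) (h₂ : z.snd = w.snd) : z = w :=
  Subtype.ext (Prod.ext h₁ h₂)

/-- `s_Z(x,y) = s_X(x)`. -/
def mom (z : FibreProd A B) : U₂ := A.right.mom z.fst

theorem mom_eq (z : FibreProd A B) : B.left.mom z.snd = z.mom := z.2.symm

theorem s_inv_eq (z : FibreProd A B) (g : G₂) (h : z.mom = 𝓖₂.r g) :
    𝓖₂.s (𝓖₂.inv g) = B.left.mom z.snd :=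
  (𝓖₂.s_inv g).trans (h.symm.trans z.2)

/-- The diagonal action `(x,y)γ = (xγ, γ⁻¹y)`. -/
def diag (z : FibreProd A B) (g : G₂) (h : z.mom = 𝓖₂.r g) : FibreProd A B :=
  ⟨(A.right.act z.fst g h, B.left.act (𝓖₂.inv g) z.snd (z.s_inv_eq g h)),
    (A.right.mom_act _ _ _).trans (((B.left.mom_act _ _ _).trans (𝓖₂.r_inv g)).symm)⟩

/-- `η(x,y) = (ηx,y)`. -/
def leftAct (g : G₁) (z : FibreProd A B) (h : 𝓖₁.s g = A.left.mom z.fst) : FibreProd A B :=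
  ⟨(A.left.act g z.fst h, z.snd), (A.right_mom_act _ _ _).trans z.2⟩

/-- `(x,y)η = (x,yη)`. -/
def rightAct (z : FibreProd A B) (g : G₃) (h : B.right.mom z.snd = 𝓖₃.r g) : FibreProd A B :=
  ⟨(z.fst, B.right.act z.snd g h), z.2.trans (B.left_mom_act _ _ _).symm⟩

/-- Two points are related if they lie in the same orbit of the diagonal action. -/
def Rel (z w : FibreProd A B) : Prop := ∃ (g : G₂) (h : z.mom = 𝓖₂.r g), w = z.diag g h

theorem rel_equivalence : Equivalence (Rel (A := A) (B := B)) where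
  refl z := by
    refine ⟨𝓖₂.one z.mom, (𝓖₂.r_one _).symm, ext' ?_ ?_⟩
    · exact (A.right.act_of_eq_one rfl _).symm
    · exact (B.left.act_of_eq_one (𝓖₂.inv_one _) _).symm
  symm := by
    rintro z _ ⟨g, h, rfl⟩
    have hm : (z.diag g h).mom = 𝓖₂.r (𝓖₂.inv g) := (A.right.mom_act _ _ _).trans (𝓖₂.r_inv g).symm
    refine ⟨𝓖₂.inv g, hm, ext' ?_ ?_⟩
    · have := A.right.act_mul z.fst g (𝓖₂.inv g) h (𝓖₂.r_inv g).symm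
      rw [A.right.act_of_eq_one (𝓖₂.mul_inv g)] at this
      exact this
    · have := B.left.mul_act (𝓖₂.inv (𝓖₂.inv g)) (𝓖₂.inv g) z.snd (𝓖₂.s_inv _) (z.s_inv_eq g h)
      rw [B.left.act_of_eq_one (𝓖₂.inv_mul (𝓖₂.inv g))] at this
      exact this
  trans := by
    rintro z _ _ ⟨g, h, rfl⟩ ⟨g', h', rfl⟩
    have hg : 𝓖₂.s g = 𝓖₂.r g' := (A.right.mom_act z.fst g h).symm.trans h'
    refine ⟨𝓖₂.mul g g' hg, h.trans (𝓖₂.r_mul _ _ _).symm, ext' ?_ ?_⟩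
    · exact (A.right.act_mul z.fst g g' h hg).symm
    · have hab : 𝓖₂.s (𝓖₂.inv g') = 𝓖₂.r (𝓖₂.inv g) :=
        (𝓖₂.s_inv g').trans (hg.symm.trans (𝓖₂.r_inv g).symm)
      refine (B.left.mul_act (𝓖₂.inv g') (𝓖₂.inv g) z.snd hab (z.s_inv_eq g h)).symm.trans ?_
      exact B.left.act_congr (𝓖₂.inv_mul_rev g g' hg).symm rfl _ _

theorem diag_leftAct (a : G₁) (z : FibreProd A B) (g : G₂) (ha : 𝓖₁.s a = A.left.mom z.fst)
    (h : z.mom = 𝓖₂.r g) :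
    (leftAct a z ha).diag g ((A.right_mom_act _ _ _).trans h) =
      leftAct a (z.diag g h) (ha.trans (A.left_mom_act _ _ _).symm) :=
  ext' (A.act_comm a z.fst g ha h) rfl

theorem diag_rightAct (z : FibreProd A B) (g : G₂) (c : G₃) (h : z.mom = 𝓖₂.r g)
    (hc : B.right.mom z.snd = 𝓖₃.r c) :
    (rightAct z c hc).diag g h =
      rightAct (z.diag g h) c ((B.right_mom_act _ _ _).trans hc) :=
  ext' rfl (B.act_comm (𝓖₂.inv g) z.snd c (z.s_inv_eq g h) hc).symm

end FibreProd

/-- The orbit space `Ω = (X ×_{U₂} Y) / G₂` of the diagonal action. -/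
def OrbitSpace (A : Bispace 𝓖₁ 𝓖₂ X) (B : Bispace 𝓖₂ 𝓖₃ Y) : Type _ :=
  Quotient (⟨FibreProd.Rel, FibreProd.rel_equivalence⟩ : Setoid (FibreProd A B))

namespace OrbitSpace

/-- The quotient topology. -/
instance [TopologicalSpace X] [TopologicalSpace Y] (A : Bispace 𝓖₁ 𝓖₂ X)
    (B : Bispace 𝓖₂ 𝓖₃ Y) : TopologicalSpace (OrbitSpace A B) :=
  inferInstanceAs (TopologicalSpace
    (Quotient (⟨FibreProd.Rel, FibreProd.rel_equivalence⟩ : Setoid (FibreProd A B))))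

/-- The Borel σ-algebra of the quotient topology. -/
instance [TopologicalSpace X] [TopologicalSpace Y] (A : Bispace 𝓖₁ 𝓖₂ X)
    (B : Bispace 𝓖₂ 𝓖₃ Y) : MeasurableSpace (OrbitSpace A B) := borel _

instance [TopologicalSpace X] [TopologicalSpace Y] (A : Bispace 𝓖₁ 𝓖₂ X)
    (B : Bispace 𝓖₂ 𝓖₃ Y) : BorelSpace (OrbitSpace A B) := ⟨rfl⟩

variable {A : Bispace 𝓖₁ 𝓖₂ X} {B : Bispace 𝓖₂ 𝓖₃ Y}

/-- The quotient map `π : Z → Ω`. -/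
def proj (z : FibreProd A B) : OrbitSpace A B := Quotient.mk _ z

/-- A chosen representative of an orbit. -/
def rep (ω : OrbitSpace A B) : FibreProd A B := Quotient.out ω

theorem proj_surjective (ω : OrbitSpace A B) : ∃ z, proj z = ω := Quotient.exists_rep ω

theorem proj_rep (ω : OrbitSpace A B) : proj (rep ω) = ω := Quotient.out_eq ω

theorem proj_eq_iff {z w : FibreProd A B} : proj z = proj w ↔ FibreProd.Rel z w :=
  ⟨fun h => Quotient.exact h, fun h => Quotient.sound h⟩

/-- The left momentum map `[x,y] ↦ r_X(x)`. -/
def leftMom (ω : OrbitSpace A B) : U₁ :=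
  Quotient.lift (fun z : FibreProd A B => A.left.mom z.fst)
    (by rintro z _ ⟨g, h, rfl⟩; exact (A.left_mom_act _ _ _).symm) ω

/-- The right momentum map `[x,y] ↦ s_Y(y)`. -/
def rightMom (ω : OrbitSpace A B) : U₃ :=
  Quotient.lift (fun z : FibreProd A B => B.right.mom z.snd)
    (by rintro z _ ⟨g, h, rfl⟩; exact (B.right_mom_act _ _ _).symm) ω

open Classical in
/-- `η[x,y] = [ηx,y]`; the value is irrelevant if `η` and `[x,y]` are not composable. -/
def leftActAux (a : G₁) (ω : OrbitSpace A B) : OrbitSpace A B :=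
  Quotient.lift (fun z : FibreProd A B =>
      if h : 𝓖₁.s a = A.left.mom z.fst then proj (FibreProd.leftAct a z h) else proj z)
    (by
      rintro z _ ⟨g, h, rfl⟩
      have hm : A.left.mom (z.diag g h).fst = A.left.mom z.fst := A.left_mom_act _ _ _
      by_cases ha : 𝓖₁.s a = A.left.mom z.fst
      · simp only [dif_pos ha, dif_pos (ha.trans hm.symm)]
        exact proj_eq_iff.2 ⟨g, _, (FibreProd.diag_leftAct a z g ha h).symm⟩
      · simp only [dif_neg ha, dif_neg (hm ▸ ha)]
        exact proj_eq_iff.2 ⟨g, h, rfl⟩) ω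

open Classical in
/-- `[x,y]η = [x,yη]`; the value is irrelevant if `[x,y]` and `η` are not composable. -/
def rightActAux (ω : OrbitSpace A B) (c : G₃) : OrbitSpace A B :=
  Quotient.lift (fun z : FibreProd A B =>
      if h : B.right.mom z.snd = 𝓖₃.r c then proj (FibreProd.rightAct z c h) else proj z)
    (by
      rintro z _ ⟨g, h, rfl⟩
      have hm : B.right.mom (z.diag g h).snd = B.right.mom z.snd := B.right_mom_act _ _ _
      by_cases hc : B.right.mom z.snd = 𝓖₃.r c
      · simp only [dif_pos hc, dif_pos (hm.trans hc)]
        exact proj_eq_iff.2 ⟨g, h, (FibreProd.diag_rightAct z g c h hc).symm⟩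
      · simp only [dif_neg hc, dif_neg (hm.symm ▸ hc)]
        exact proj_eq_iff.2 ⟨g, h, rfl⟩) ω

theorem leftActAux_proj (a : G₁) (z : FibreProd A B) (h : 𝓖₁.s a = A.left.mom z.fst) :
    leftActAux a (proj z) = proj (FibreProd.leftAct a z h) := dif_pos h

theorem rightActAux_proj (z : FibreProd A B) (c : G₃) (h : B.right.mom z.snd = 𝓖₃.r c) :
    rightActAux (proj z) c = proj (FibreProd.rightAct z c h) := dif_pos h

variable (A B) in
/-- The `G₁`-`G₃`-bispace structure on `Ω` induced from `Z`. -/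
def bispace : Bispace 𝓖₁ 𝓖₃ (OrbitSpace A B) where
  left :=
    { mom := leftMom
      act := fun a ω _ => leftActAux a ω
      mom_act := fun a ω => by
        obtain ⟨z, rfl⟩ := proj_surjective ω
        intro h
        rw [leftActAux_proj a z h]
        exact A.left.mom_act _ _ _
      one_act := fun ω => by
        obtain ⟨z, rfl⟩ := proj_surjective ω
        refine (leftActAux_proj _ z (𝓖₁.s_one _)).trans ?_
        exact congrArg proj (FibreProd.ext' (A.left.one_act _) rfl)
      mul_act := fun a b ω => by
        obtain ⟨z, rfl⟩ := proj_surjective ω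
        intro hab h
        rw [leftActAux_proj _ z ((𝓖₁.s_mul a b hab).trans h), leftActAux_proj b z h,
          leftActAux_proj a _ (hab.trans (A.left.mom_act b z.fst h).symm)]
        exact congrArg proj (FibreProd.ext' (A.left.mul_act a b z.fst hab h) rfl) }
  right :=
    { mom := rightMom
      act := fun ω c _ => rightActAux ω c
      mom_act := fun ω c => by
        obtain ⟨z, rfl⟩ := proj_surjective ω
        intro h
        rw [rightActAux_proj z c h]
        exact B.right.mom_act _ _ _
      act_one := fun ω => by
        obtain ⟨z, rfl⟩ := proj_surjective ω
        refine (rightActAux_proj z _ (𝓖₃.r_one _).symm).trans ?_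
        exact congrArg proj (FibreProd.ext' rfl (B.right.act_one _))
      act_mul := fun ω a b => by
        obtain ⟨z, rfl⟩ := proj_surjective ω
        intro h hab
        rw [rightActAux_proj z _ (h.trans (𝓖₃.r_mul a b hab).symm), rightActAux_proj z a h,
          rightActAux_proj _ b ((B.right.mom_act z.snd a h).trans hab)]
        exact congrArg proj (FibreProd.ext' rfl (B.right.act_mul z.snd a b h hab)) }
  left_mom_act := fun ω c => by
    obtain ⟨z, rfl⟩ := proj_surjective ω
    intro h
    change leftMom (rightActAux (proj z) c) = _
    rw [rightActAux_proj z c h]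
    rfl
  right_mom_act := fun a ω => by
    obtain ⟨z, rfl⟩ := proj_surjective ω
    intro h
    change rightMom (leftActAux a (proj z)) = _
    rw [leftActAux_proj a z h]
    rfl
  act_comm := fun a ω c => by
    obtain ⟨z, rfl⟩ := proj_surjective ω
    intro h h'
    change 𝓖₁.s a = A.left.mom z.fst at h
    change B.right.mom z.snd = 𝓖₃.r c at h'
    change rightActAux (leftActAux a (proj z)) c = leftActAux a (rightActAux (proj z) c)
    rw [leftActAux_proj a z h, rightActAux_proj z c h']
    exact (rightActAux_proj (FibreProd.leftAct a z h) c h').trans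
      (leftActAux_proj a (FibreProd.rightAct z c h') h).symm

end OrbitSpace

end Composite

section CompositeMeasures

variable {G₁ U₁ G₂ U₂ G₃ U₃ X Y : Type*}
  [TopologicalSpace G₁] [TopologicalSpace U₁] [TopologicalSpace G₂] [TopologicalSpace U₂]
  [TopologicalSpace G₃] [TopologicalSpace U₃] [TopologicalSpace X] [TopologicalSpace Y]
  [MeasurableSpace G₁] [MeasurableSpace G₂] [MeasurableSpace G₃]
  [MeasurableSpace X] [MeasurableSpace Y]
  {𝓖₁ : HaarGroupoid G₁ U₁} {𝓖₂ : HaarGroupoid G₂ U₂} {𝓖₃ : HaarGroupoid G₃ U₃}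

/-- A 0-cochain `b` on `(X ×_{U₂} Y) ⋊ G₂` as used to form composites: a `G₃`-invariant continuous
function `b : Z → (0,∞)` with `d⁰(b) = D`, where `d⁰(b)(z,γ) = b(zγ)/b(z)` and
`D((x,y),γ) = Δ₂(γ⁻¹,y)` for the adjoining function `Δ₂` of the second correspondence. -/
structure IsCompositeCochain (𝒳 : TopologicalCorrespondence 𝓖₁ 𝓖₂ X)
    (𝒴 : TopologicalCorrespondence 𝓖₂ 𝓖₃ Y)
    (b : FibreProd 𝒳.toBispace 𝒴.toBispace → ℝ) : Prop where
  continuous : Continuous b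
  pos : ∀ z, 0 < b z
  invariant : ∀ z c (h : 𝒴.right.mom z.snd = 𝓖₃.r c), b (z.rightAct c h) = b z
  coboundary : ∀ z g (h : z.mom = 𝓖₂.r g),
    b (z.diag g h) / b z = 𝒴.adj ⟨(𝓖₂.inv g, z.snd), z.s_inv_eq g h⟩

/-- `∫_Z F dλ^ω = ∫ F(xγ, γ⁻¹y) dχ₂(γ)` for `ω = [x,y]`; by left invariance of the Haar system
this does not depend on the representative. -/
def orbitIntegral (𝒳 : TopologicalCorrespondence 𝓖₁ 𝓖₂ X)
    (𝒴 : TopologicalCorrespondence 𝓖₂ 𝓖₃ Y)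
    (F : FibreProd 𝒳.toBispace 𝒴.toBispace → ℝ)
    (ω : OrbitSpace 𝒳.toBispace 𝒴.toBispace) : ℝ :=
  ∫ g, (open Classical in if h : ω.rep.mom = 𝓖₂.r g then F (ω.rep.diag g h) else 0)
    ∂(𝓖₂.haar ω.rep.mom)

/-- `∫_Z F dm_u = ∫_Y ∫_X F(x,y) dα_{r_Y(y)}(x) dβ_u(y)`, that is, the integral of `F` with respect
to `α × β_u`. -/
def fibreProdIntegral (𝒳 : TopologicalCorrespondence 𝓖₁ 𝓖₂ X)
    (𝒴 : TopologicalCorrespondence 𝓖₂ 𝓖₃ Y) (u : U₃)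
    (F : FibreProd 𝒳.toBispace 𝒴.toBispace → ℝ) : ℝ :=
  ∫ y, ∫ x, (open Classical in
      if h : 𝒳.right.mom x = 𝒴.left.mom y then F ⟨(x, y), h⟩ else 0)
    ∂(𝒳.lam (𝒴.left.mom y)) ∂(𝒴.lam u)

/-- `(Ω, μ)`, with `Ω = (X ×_{U₂} Y)/G₂`, is the composite of `𝒳` and `𝒴` obtained by using the
0-cochain `b`: each `μ u` is a Radon measure on `Ω` which lifts to `b (α × β_u)` on `Z`, that is,
`∫_Ω ∫_Z F dλ^ω dμ_u(ω) = ∫_Z F b d(α × β_u)` for all `F ∈ C_c(Z)`. -/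
structure IsComposite (𝒳 : TopologicalCorrespondence 𝓖₁ 𝓖₂ X)
    (𝒴 : TopologicalCorrespondence 𝓖₂ 𝓖₃ Y)
    (b : FibreProd 𝒳.toBispace 𝒴.toBispace → ℝ)
    (μ : U₃ → Measure (OrbitSpace 𝒳.toBispace 𝒴.toBispace)) : Prop where
  cochain : IsCompositeCochain 𝒳 𝒴 b
  regular : ∀ u, (μ u).Regular
  lift : ∀ (u : U₃) (F : C_c(FibreProd 𝒳.toBispace 𝒴.toBispace, ℝ)),
    ∫ ω, orbitIntegral 𝒳 𝒴 F ω ∂(μ u) = fibreProdIntegral 𝒳 𝒴 u fun z => F z * b z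

end CompositeMeasures

end

/-! A properly acting groupoid with paracompact orbit space has a cutoff function `φ` on the total
space: it is continuous, nonnegative, and has integral `1` over each orbit. Every `f ∈ C_c(Ω)` is
thus the orbit integral of `φ (f ∘ π) ∈ C_c(Z)`, and the lifting condition becomes the formula
`∫ f dμ_u = ∫ φ (f ∘ π) b d(α × β_u)`. Two cochains satisfy the same coboundary equation, so their
quotient `c` is constant on orbits, and the formula gives `∫ f dμ'_u = ∫ f c dμ_u`; hence
`μ'_u = c μ_u`, by a comparison of Radon measures that needs no `σ`-finiteness.

The adjoining identity of `X`, applied on the fibres of `Z → Y`, shows that `b (α × β_u)` is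
quasi-invariant under `G₁` with weight `Δ₁(g, x) b(x, y) / b(gx, y)`. Averaging this weight over the
orbits with the help of `φ` yields a continuous adjoining function on `G₁ ⋉ Ω`.
-/

noncomputable section

section CompactSupport

variable {X : Type*} [TopologicalSpace X] [T2Space X] [LocallyCompactSpace X]

theorem exists_compactlySupported_eq_one {K V : Set X} (hK : IsCompact K) (hV : IsOpen V)
    (hKV : K ⊆ V) :
    ∃ f : C_c(X, ℝ), (∀ x ∈ K, f x = 1) ∧ (∀ x, f x ∈ Set.Icc 0 1) ∧ Function.support f ⊆ V := by
  obtain ⟨χ, hχ_one, hχ_compact, hχV, hχ_mem⟩ :=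
    exists_continuousMap_one_of_isCompact_subset_isOpen hK hV hKV
  exact ⟨⟨χ, hχ_compact⟩, hχ_one, hχ_mem, (subset_tsupport _).trans hχV⟩

theorem exists_compactlySupported_eqOn {S K : Set X} (hS : IsClosed S) (hK : IsCompact K)
    {f : X → ℝ} (hf : ContinuousOn f S) (hfK : ∀ x ∈ S, f x ≠ 0 → x ∈ K) :
    ∃ F : C_c(X, ℝ), Set.EqOn F f S := by
  classical
  obtain ⟨K', hK', hKK'⟩ := exists_compact_superset hK
  obtain ⟨χ, hχ_one, hχ_compact, hχK', -⟩ :=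
    exists_continuousMap_one_of_isCompact_subset_isOpen hK isOpen_interior hKK'
  -- Tietze's theorem is applied on `K'`, which is normal, whereas `X` need not be.
  have : CompactSpace K' := isCompact_iff_compactSpace.1 hK'
  have hfS : Continuous fun x : (Subtype.val ⁻¹' S : Set K') => f x :=
    hf.comp_continuous (by fun_prop) fun x => x.2
  obtain ⟨g, hg⟩ := ContinuousMap.exists_restrict_eq (hS.preimage continuous_subtype_val) ⟨_, hfS⟩
  have hgf : ∀ x (hx : x ∈ K'), x ∈ S → g ⟨x, hx⟩ = f x := fun x hx hxS =>
    DFunLike.congr_fun hg ⟨⟨x, hx⟩, hxS⟩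
  let G : X → ℝ := fun x => if hx : x ∈ K' then g ⟨x, hx⟩ else 0
  have hG : ContinuousOn G K' := by
    rw [continuousOn_iff_continuous_domRestrict, show K'.domRestrict G = g from
      funext fun x => dif_pos x.2]
    exact g.continuous
  have hχG : Continuous fun x => χ x * G x :=
    ((map_continuous χ).continuousOn.mul (hG.mono interior_subset)).continuous_of_tsupport_subset
      isOpen_interior ((tsupport_mul_subset_left (f := χ)).trans hχK')
  refine ⟨⟨⟨_, hχG⟩, HasCompactSupport.mul_right (f := χ) hχ_compact⟩, fun x hxS => ?_⟩
  change χ x * G x = f x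
  by_cases hxK : x ∈ K
  · have hxK' : x ∈ K' := interior_subset (hKK' hxK)
    simp only [G, dif_pos hxK', hχ_one hxK, hgf x hxK' hxS, Pi.one_apply, one_mul]
  · have hfx : f x = 0 := not_imp_comm.1 (hfK x hxS) hxK
    by_cases hxK' : x ∈ K'
    · simp only [G, dif_pos hxK', hgf x hxK' hxS, hfx, mul_zero]
    · simp only [G, dif_neg hxK', hfx, mul_zero]

end CompactSupport

section Density

theorem le_withDensity_of_forall_lt_measure_le {X : Type*} [MeasurableSpace X] {μ ν : Measure X}
    {d : X → ENNReal} (hd : Measurable d) (hd_zero : ∀ x, d x ≠ 0) (hd_top : ∀ x, d x ≠ ⊤)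
    (h : ∀ (B : NNReal) (A : Set X), (∀ x ∈ A, d x < B) → ν A ≤ B * μ A) :
    ν ≤ μ.withDensity d := by
  -- On the slice where `t ^ n ≤ d < t ^ (n + 1)`, the two measures compare up to the factor `t`.
  have le_mul : ∀ t : NNReal, 1 < t → ∀ A, MeasurableSet A → ν A ≤ t * μ.withDensity d A := by
    intro t ht A hA
    have hzero : d ⁻¹' {0} = ∅ := Set.eq_empty_of_forall_notMem hd_zero
    have htop : d ⁻¹' {⊤} = ∅ := Set.eq_empty_of_forall_notMem hd_top
    rw [measure_eq_measure_preimage_add_measure_tsum_Ico_zpow ν hd hA ht,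
      measure_eq_measure_preimage_add_measure_tsum_Ico_zpow (μ.withDensity d) hd hA ht, hzero, htop]
    simp only [Set.inter_empty, measure_empty, zero_add, ← ENNReal.tsum_mul_left]
    refine ENNReal.tsum_le_tsum fun n => ?_
    have ht_ne : t ≠ 0 := (zero_lt_one.trans ht).ne'
    set slice := A ∩ d ⁻¹' Set.Ico ((t : ENNReal) ^ n) (t ^ (n + 1))
    have hslice : MeasurableSet slice := hA.inter (hd measurableSet_Ico)
    calc ν slice ≤ (t ^ (n + 1) : NNReal) * μ slice :=
          h _ _ fun x hx => by rw [ENNReal.coe_zpow ht_ne]; exact hx.2.2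
      _ = t * (t ^ n * μ slice) := by
          rw [ENNReal.coe_zpow ht_ne, ENNReal.zpow_add (by simpa using ht_ne) (by simp), zpow_one]
          ring
      _ ≤ t * μ.withDensity d slice := by
          gcongr
          rw [withDensity_apply _ hslice, ← setLIntegral_const]
          exact setLIntegral_mono hd fun x hx => hx.2.1
  refine Measure.le_iff.2 fun A hA => ENNReal.le_of_forall_lt_one_mul_le fun a ha => ?_
  lift a to NNReal using (ha.trans ENNReal.one_lt_top).ne
  rcases eq_or_ne a 0 with rfl | ha_ne
  · simp
  have hle := le_mul a⁻¹ ((one_lt_inv₀ (pos_iff_ne_zero.2 ha_ne)).2 (mod_cast ha)) A hA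
  rw [ENNReal.coe_inv ha_ne] at hle
  exact ENNReal.mul_le_of_le_div' (by rwa [ENNReal.div_eq_inv_mul])

variable {X : Type*} [TopologicalSpace X] [T2Space X] [LocallyCompactSpace X] [MeasurableSpace X]
  [BorelSpace X] {μ ν : Measure X} {c : X → ℝ}

theorem measure_isOpen_le_of_integral_eq_integral_mul [IsFiniteMeasureOnCompacts μ] [ν.Regular]
    (hc : Continuous c) (h : ∀ f : C_c(X, ℝ), ∫ x, f x ∂ν = ∫ x, f x * c x ∂μ) {B : ℝ}
    {V : Set X} (hV : IsOpen V) (hB : ∀ x ∈ V, c x ≤ B) : ν V ≤ ENNReal.ofReal B * μ V := by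
  rw [hV.measure_eq_iSup_isCompact]
  refine iSup₂_le fun K hKV => iSup_le fun hK => ?_
  obtain ⟨f, hf_one, hf_mem, hfV⟩ := exists_compactlySupported_eq_one hK hV hKV
  have hf_zero : ∀ x ∉ V, f x = 0 := fun x hx => Function.notMem_support.1 fun h => hx (hfV h)
  have hf_nonneg : ∀ x, 0 ≤ f x := fun x => (hf_mem x).1
  have hfc_le : ∫ x, f x * c x ∂μ ≤ ∫ x, B * f x ∂μ := by
    refine integral_mono ?_ (f.integrable.const_mul _) fun x => ?_
    · exact (f.continuous.mul hc).integrable_of_hasCompactSupport f.hasCompactSupport.mul_right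
    · by_cases hx : x ∈ V
      · simpa only [mul_comm] using mul_le_mul_of_nonneg_left (hB x hx) (hf_nonneg x)
      · simp [hf_zero x hx]
  calc ν K ≤ ENNReal.ofReal (∫ x, f x ∂ν) :=
        f.integrable.measure_le_integral (.of_forall hf_nonneg) fun x hx => (hf_one x hx).ge
    _ ≤ ENNReal.ofReal (B * ∫ x, f x ∂μ) := by
        rw [h, ← integral_const_mul]
        exact ENNReal.ofReal_le_ofReal hfc_le
    _ = ENNReal.ofReal B * ENNReal.ofReal (∫ x, f x ∂μ) :=
        ENNReal.ofReal_mul' (integral_nonneg hf_nonneg)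
    _ ≤ ENNReal.ofReal B * μ V := by
        gcongr
        exact integral_le_measure (fun x _ => (hf_mem x).2) fun x hx => (hf_zero x hx).le

theorem measure_le_of_integral_eq_integral_mul [μ.Regular] [ν.Regular] (hc : Continuous c)
    (h : ∀ f : C_c(X, ℝ), ∫ x, f x ∂ν = ∫ x, f x * c x ∂μ) {B : ℝ} (hB_pos : 0 < B) {A : Set X}
    (hB : ∀ x ∈ A, c x < B) : ν A ≤ ENNReal.ofReal B * μ A := by
  have hB_ne : ENNReal.ofReal B ≠ 0 := by simpa using hB_pos
  rw [mul_comm, ← ENNReal.div_le_iff_le_mul (.inl hB_ne) (.inl ENNReal.ofReal_ne_top),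
    A.measure_eq_iInf_isOpen μ]
  refine le_iInf₂ fun V hAV => le_iInf fun hV => ?_
  rw [ENNReal.div_le_iff_le_mul (.inl hB_ne) (.inl ENNReal.ofReal_ne_top), mul_comm]
  calc ν A ≤ ν (V ∩ {x | c x < B}) := measure_mono fun x hx => ⟨hAV hx, hB x hx⟩
    _ ≤ ENNReal.ofReal B * μ (V ∩ {x | c x < B}) :=
      measure_isOpen_le_of_integral_eq_integral_mul hc h
        (hV.inter (isOpen_lt hc continuous_const)) fun x hx => hx.2.le
    _ ≤ ENNReal.ofReal B * μ V := by gcongr; exact Set.inter_subset_left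

theorem le_withDensity_of_integral_eq_integral_mul [μ.Regular] [ν.Regular] (hc : Continuous c)
    (hc_pos : ∀ x, 0 < c x) (h : ∀ f : C_c(X, ℝ), ∫ x, f x ∂ν = ∫ x, f x * c x ∂μ) :
    ν ≤ μ.withDensity fun x => ENNReal.ofReal (c x) := by
  refine le_withDensity_of_forall_lt_measure_le hc.measurable.ennreal_ofReal
    (fun x => by simpa using hc_pos x) (fun x => ENNReal.ofReal_ne_top) fun B A hB => ?_
  rcases A.eq_empty_or_nonempty with rfl | ⟨x, hx⟩
  · simp
  have hB_pos : (0 : ℝ) < B := by exact_mod_cast (zero_le (a := _)).trans_lt (hB x hx)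
  have hcB : ∀ x ∈ A, c x < B := fun x hx =>
    (ENNReal.ofReal_lt_ofReal_iff hB_pos).1 (by simpa using hB x hx)
  simpa using measure_le_of_integral_eq_integral_mul hc h hB_pos hcB

/- For measures that are not `σ`-finite, the right-hand side is not known to be regular beforehand,
so uniqueness in the Riesz representation theorem does not apply. -/
theorem eq_withDensity_of_integral_eq_integral_mul [μ.Regular] [ν.Regular] (hc : Continuous c)
    (hc_pos : ∀ x, 0 < c x) (h : ∀ f : C_c(X, ℝ), ∫ x, f x ∂ν = ∫ x, f x * c x ∂μ) :
    ν = μ.withDensity fun x => ENNReal.ofReal (c x) := by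
  refine le_antisymm (le_withDensity_of_integral_eq_integral_mul hc hc_pos h) ?_
  have hc_inv : Continuous fun x => (c x)⁻¹ := hc.inv₀ fun x => (hc_pos x).ne'
  have h_inv : ∀ f : C_c(X, ℝ), ∫ x, f x ∂μ = ∫ x, f x * (c x)⁻¹ ∂ν := fun f => by
    refine Eq.trans (integral_congr_ae (.of_forall fun x => ?_))
      (h ⟨⟨fun x => f x * (c x)⁻¹, f.continuous.mul hc_inv⟩, f.hasCompactSupport.mul_right⟩).symm
    simp [(hc_pos x).ne']
  have hμ_le : μ ≤ ν.withDensity fun x => (ENNReal.ofReal (c x))⁻¹ := by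
    simpa only [ENNReal.ofReal_inv_of_pos (hc_pos _)] using
      le_withDensity_of_integral_eq_integral_mul hc_inv (fun x => inv_pos.2 (hc_pos x)) h_inv
  calc μ.withDensity (fun x => ENNReal.ofReal (c x))
      ≤ (ν.withDensity fun x => (ENNReal.ofReal (c x))⁻¹).withDensity
          fun x => ENNReal.ofReal (c x) := Measure.le_iff.2 fun A hA => by
        rw [withDensity_apply _ hA, withDensity_apply _ hA]
        exact lintegral_mono' (Measure.restrict_mono le_rfl hμ_le) le_rfl
    _ = ν := by
        have hc_meas : Measurable fun x => ENNReal.ofReal (c x) := hc.measurable.ennreal_ofReal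
        refine (withDensity_mul ν hc_meas.inv hc_meas).symm.trans ?_
        refine (congrArg ν.withDensity (funext fun x => ?_)).trans withDensity_one
        exact ENNReal.inv_mul_cancel (by simpa using hc_pos x) ENNReal.ofReal_ne_top

end Density


section FibreIntegral

theorem eventually_forall_abs_sub_lt {X U T : Type*} [TopologicalSpace X] [TopologicalSpace U]
    [T2Space U] [TopologicalSpace T] {p : X → U} (hp : Continuous p) {q : T → U}
    (hq : Continuous q) {F : T → X → ℝ}
    (hF : ContinuousOn (fun a : T × X => F a.1 a.2) {a | p a.2 = q a.1}) {t₀ : T} {f : X → ℝ}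
    (hf : Continuous f) (hFf : ∀ x, p x = q t₀ → F t₀ x = f x) {K : Set X} (hK : IsCompact K)
    {ε : ℝ} (hε : 0 < ε) :
    ∀ᶠ t in 𝓝 t₀, ∀ x ∈ K, p x = q t → |F t x - f x| < ε := by
  refine hK.eventually_forall_of_forall_eventually fun x _ => ?_
  by_cases hx : p x = q t₀
  · have hdiff : ContinuousWithinAt (fun a : T × X => |F a.1 a.2 - f a.2|)
        {a | p a.2 = q a.1} (t₀, x) :=
      ((hF _ hx).sub (hf.comp continuous_snd).continuousWithinAt).abs
    exact eventually_nhdsWithin_iff.1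
      (hdiff.eventually (gt_mem_nhds (by simpa [hFf x hx] using hε)))
  · have hne : ∀ᶠ a : T × X in 𝓝 (t₀, x), p a.2 ≠ q a.1 :=
      (isOpen_ne_fun (hp.comp continuous_snd) (hq.comp continuous_fst)).mem_nhds hx
    filter_upwards [hne] with a ha hpq using absurd hpq ha

variable {X U : Type*} [TopologicalSpace X] [MeasurableSpace X] [TopologicalSpace U]
  {p : X → U} {lam : U → Measure X}

namespace IsContinuousFamily

theorem ae_eq (h : IsContinuousFamily p lam) (u : U) : ∀ᵐ x ∂lam u, p x = u := h.concentrated u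

theorem integral_congr (h : IsContinuousFamily p lam) {u : U} {f g : X → ℝ}
    (hfg : ∀ x, p x = u → f x = g x) : ∫ x, f x ∂lam u = ∫ x, g x ∂lam u :=
  integral_congr_ae ((h.ae_eq u).mono hfg)

theorem integral_eq_zero (h : IsContinuousFamily p lam) {u : U} {f : X → ℝ}
    (hf : ∀ x, p x = u → f x = 0) : ∫ x, f x ∂lam u = 0 :=
  integral_eq_zero_of_ae ((h.ae_eq u).mono hf)

theorem integrable_compactlySupported [OpensMeasurableSpace X] (h : IsContinuousFamily p lam)
    (f : C_c(X, ℝ)) (u : U) : Integrable f (lam u) := by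
  have := h.regular u
  exact f.integrable

theorem abs_integral_le [OpensMeasurableSpace X] (h : IsContinuousFamily p lam) {u : U}
    {f : X → ℝ} {k : C_c(X, ℝ)} {ε : ℝ} (hfk : ∀ x, p x = u → |f x| ≤ ε * k x) :
    |∫ x, f x ∂lam u| ≤ ε * ∫ x, k x ∂lam u := by
  rw [← integral_const_mul]
  exact norm_integral_le_of_norm_le (f := f) ((h.integrable_compactlySupported k u).const_mul ε)
    ((h.ae_eq u).mono hfk)

variable [BorelSpace X] [T2Space X] [LocallyCompactSpace X] [T2Space U]

theorem integrable (h : IsContinuousFamily p lam) (hp : Continuous p) (u : U)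
    {f : X → ℝ} (hf : ContinuousOn f (p ⁻¹' {u})) {K : Set X} (hK : IsCompact K)
    (hfK : ∀ x, p x = u → f x ≠ 0 → x ∈ K) : Integrable f (lam u) := by
  obtain ⟨F, hF⟩ := exists_compactlySupported_eqOn (isClosed_singleton.preimage hp) hK hf hfK
  exact (h.integrable_compactlySupported F u).congr ((h.ae_eq u).mono hF)

/- `F t₀` is extended from its fibre to `f ∈ C_c(X)`, whose integrals vary continuously; near `t₀`,
the functions `F t` and `f` are uniformly close on the fibre over `q t`. -/
theorem continuousAt_integral (h : IsContinuousFamily p lam) (hp : Continuous p) {T : Type*}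
    [TopologicalSpace T] {q : T → U} (hq : Continuous q) {F : T → X → ℝ}
    (hF : ContinuousOn (fun a : T × X => F a.1 a.2) {a | p a.2 = q a.1}) {t₀ : T} {N : Set T}
    (hN : N ∈ 𝓝 t₀) {K : Set X} (hK : IsCompact K)
    (hFK : ∀ t ∈ N, ∀ x, p x = q t → F t x ≠ 0 → x ∈ K) :
    ContinuousAt (fun t => ∫ x, F t x ∂lam (q t)) t₀ := by
  have hF_fibre : ∀ t, ContinuousOn (F t) (p ⁻¹' {q t}) := fun t =>
    hF.comp (by fun_prop : ContinuousOn (fun x => (t, x)) _) fun x hx => hx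
  have hcont : ∀ f : C_c(X, ℝ), ContinuousAt (fun t => ∫ x, f x ∂lam (q t)) t₀ := fun f =>
    ((h.continuous_integral f).comp hq).continuousAt
  obtain ⟨f, hf⟩ := exists_compactlySupported_eqOn (isClosed_singleton.preimage hp) hK
    (hF_fibre t₀) (hFK t₀ (mem_of_mem_nhds hN))
  have hK' : IsCompact (K ∪ tsupport f) := hK.union f.hasCompactSupport
  obtain ⟨k, hk_one, hk_mem, -⟩ :=
    exists_compactlySupported_eq_one hK' isOpen_univ (Set.subset_univ _)
  suffices hlim : Filter.Tendsto
      (fun t => (∫ x, F t x ∂lam (q t)) - ∫ x, f x ∂lam (q t)) (𝓝 t₀) (𝓝 0) by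
    simpa [ContinuousAt, h.integral_congr hf] using hlim.add (hcont f).tendsto
  refine Metric.tendsto_nhds.2 fun ε hε => ?_
  set M := (∫ x, k x ∂lam (q t₀)) + 1
  have hM : 0 < M := add_pos_of_nonneg_of_pos (integral_nonneg fun x => (hk_mem x).1) one_pos
  filter_upwards [eventually_forall_abs_sub_lt hp hq hF f.continuous (fun x hx => (hf hx).symm) hK'
    (div_pos hε hM), (hcont k).eventually (gt_mem_nhds (lt_add_one _)), hN] with t hclose hkM htN
  have hle : ∀ x, p x = q t → |F t x - f x| ≤ ε / M * k x := fun x hx => by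
    by_cases hxK : x ∈ K ∪ tsupport f
    · simpa [hk_one x hxK] using (hclose x hxK hx).le
    · rw [not_imp_comm.1 (hFK t htN x hx) fun h => hxK (.inl h),
        image_eq_zero_of_notMem_tsupport fun h => hxK (.inr h), sub_self, abs_zero]
      exact mul_nonneg (by positivity) (hk_mem x).1
  rw [dist_zero_right, ← integral_sub (h.integrable hp _ (hF_fibre t) hK (hFK t htN))
    (h.integrable_compactlySupported f _)]
  calc |∫ x, (F t x - f x) ∂lam (q t)| ≤ ε / M * ∫ x, k x ∂lam (q t) := h.abs_integral_le hle
    _ < ε / M * M := by gcongr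
    _ = ε := div_mul_cancel₀ _ hM.ne'

theorem continuous_fibre_integral (h : IsContinuousFamily p lam)
    (hp : Continuous p) {T : Type*} [TopologicalSpace T] {q : T → U} (hq : Continuous q)
    {F : T → X → ℝ} (hF : ContinuousOn (fun a : T × X => F a.1 a.2) {a | p a.2 = q a.1})
    (hFK : ∀ t₀, ∃ N ∈ 𝓝 t₀, ∃ K, IsCompact K ∧
      ∀ t ∈ N, ∀ x, p x = q t → F t x ≠ 0 → x ∈ K) :
    Continuous fun t => ∫ x, F t x ∂lam (q t) :=
  continuous_iff_continuousAt.2 fun t₀ =>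
    let ⟨_, hN, _, hK, hNK⟩ := hFK t₀
    h.continuousAt_integral hp hq hF hN hK hNK

/- Fubini's theorem without `σ`-finiteness: `F` is replaced by a function in `C_c(X × Y)`. -/
theorem integral_swap {Y V : Type*} [TopologicalSpace Y] [MeasurableSpace Y]
    [BorelSpace Y] [T2Space Y] [LocallyCompactSpace Y] [TopologicalSpace V] [T2Space V]
    {q : Y → V} {nu : V → Measure Y} (h : IsContinuousFamily p lam) (hp : Continuous p)
    (h' : IsContinuousFamily q nu) (hq : Continuous q) {u : U} {v : V} {F : X → Y → ℝ}
    (hF : ContinuousOn (fun a : X × Y => F a.1 a.2) {a | p a.1 = u ∧ q a.2 = v})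
    {K : Set X} {L : Set Y} (hK : IsCompact K) (hL : IsCompact L)
    (hFK : ∀ x y, p x = u → q y = v → F x y ≠ 0 → x ∈ K ∧ y ∈ L) :
    ∫ x, ∫ y, F x y ∂nu v ∂lam u = ∫ y, ∫ x, F x y ∂lam u ∂nu v := by
  have := h.regular u
  have := h'.regular v
  have hfibre : IsClosed {a : X × Y | p a.1 = u ∧ q a.2 = v} :=
    (isClosed_eq (hp.comp continuous_fst) continuous_const).inter
      (isClosed_eq (hq.comp continuous_snd) continuous_const)
  obtain ⟨f, hf⟩ := exists_compactlySupported_eqOn hfibre (hK.prod hL) hF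
    (fun a ha => hFK a.1 a.2 ha.1 ha.2)
  have hf_eq : ∀ x y, p x = u → q y = v → f (x, y) = F x y := fun x y hx hy =>
    hf (x := (x, y)) ⟨hx, hy⟩
  calc ∫ x, ∫ y, F x y ∂nu v ∂lam u = ∫ x, ∫ y, f (x, y) ∂nu v ∂lam u :=
        h.integral_congr fun x hx => h'.integral_congr fun y hy => (hf_eq x y hx hy).symm
    _ = ∫ y, ∫ x, f (x, y) ∂lam u ∂nu v :=
        integral_integral_swap_of_hasCompactSupport (f := fun x y => f (x, y))
          f.continuous f.hasCompactSupport
    _ = ∫ y, ∫ x, F x y ∂lam u ∂nu v :=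
        h'.integral_congr fun y hy => h.integral_congr fun x hx => hf_eq x y hx hy

end IsContinuousFamily

end FibreIntegral

section Groupoid

variable {G U : Type*} [TopologicalSpace G] [TopologicalSpace U]

theorem TopGroupoid.t2Space_units [T2Space G] (𝓖 : TopGroupoid G U) : T2Space U :=
  T2Space.of_injective_continuous (f := 𝓖.one) (Function.LeftInverse.injective 𝓖.r_one)
    𝓖.continuous_one

theorem TopGroupoid.inv_inv (𝓖 : TopGroupoid G U) (a : G) : 𝓖.inv (𝓖.inv a) = a := by
  refine (𝓖.eq_inv (𝓖.r_inv a).symm ?_).symm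
  rw [𝓖.mul_inv, 𝓖.s_inv]

/- If `f ∈ C_c(G)` is supported near `g` and `f g = 1`, then `u ↦ ∫ f dα^u` is positive near `r g`,
so `f` cannot vanish on the fibre of `r` over any `u` near `r g`. -/
theorem HaarGroupoid.isOpenMap_r [T2Space G] [LocallyCompactSpace G] [MeasurableSpace G]
    [BorelSpace G] (𝓖 : HaarGroupoid G U) : IsOpenMap 𝓖.r := by
  refine isOpenMap_iff_nhds_le.2 fun g W hW => ?_
  obtain ⟨V, hVW, hV, hgV⟩ := mem_nhds_iff.1 (Filter.mem_map.1 hW)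
  obtain ⟨f, hf_one, hf_mem, hfV⟩ := exists_compactlySupported_eq_one
    (isCompact_singleton (x := g)) hV (Set.singleton_subset_iff.2 hgV)
  have hpos : 0 < ∫ x, f x ∂𝓖.haar (𝓖.r g) := by
    rw [integral_pos_iff_support_of_nonneg (fun x => (hf_mem x).1)
      (𝓖.haar_family.integrable_compactlySupported f _)]
    exact 𝓖.haar_full _ _ f.continuous.isOpen_support ⟨g, by simp [hf_one g rfl], rfl⟩
  filter_upwards [(𝓖.haar_family.continuous_integral f).continuousAt.eventually
    (lt_mem_nhds hpos)] with u hu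
  by_contra huW
  refine hu.ne' (𝓖.haar_family.integral_eq_zero fun x hx => ?_)
  by_contra hfx
  exact huW (hx ▸ hVW (hfV hfx))

end Groupoid


section TotalActions

variable {H V Z : Type*} [TopologicalSpace H] [TopologicalSpace V] {𝓗 : TopGroupoid H V}

open Classical in
/-- A right action, extended by `(x, g) ↦ x` to pairs that are not composable. This makes it
possible to speak of continuity on subsets of `Z × H` instead of on subtypes. -/
def RightAction.totalAct (R : RightAction 𝓗 Z) (x : Z) (g : H) : Z :=
  if h : R.mom x = 𝓗.r g then R.act x g h else x

theorem RightAction.totalAct_eq (R : RightAction 𝓗 Z) {x : Z} {g : H} (h : R.mom x = 𝓗.r g) :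
    R.totalAct x g = R.act x g h := dif_pos h

open Classical in
/-- A left action, extended by `(g, x) ↦ x` to pairs that are not composable. -/
def LeftAction.totalAct (L : LeftAction 𝓗 Z) (g : H) (x : Z) : Z :=
  if h : 𝓗.s g = L.mom x then L.act g x h else x

theorem LeftAction.totalAct_eq (L : LeftAction 𝓗 Z) {x : Z} {g : H} (h : 𝓗.s g = L.mom x) :
    L.totalAct g x = L.act g x h := dif_pos h

theorem RightAction.totalAct_act (R : RightAction 𝓗 Z) {z : Z} {a b : H}
    (h : R.mom z = 𝓗.r a) (hab : 𝓗.s a = 𝓗.r b) :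
    R.totalAct (R.act z a h) b = R.totalAct z (𝓗.mul a b hab) := by
  rw [R.totalAct_eq ((R.mom_act z a h).trans hab), R.totalAct_eq (h.trans (𝓗.r_mul a b hab).symm),
    R.act_mul]

theorem LeftAction.mom_totalAct_inv (L : LeftAction 𝓗 Z) {g : H} {z : Z} (h : 𝓗.r g = L.mom z) :
    L.mom (L.totalAct (𝓗.inv g) z) = 𝓗.s g := by
  rw [L.totalAct_eq ((𝓗.s_inv g).trans h), L.mom_act, 𝓗.r_inv]

theorem LeftAction.totalAct_totalAct_inv (L : LeftAction 𝓗 Z) {g : H} {z : Z}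
    (h : 𝓗.r g = L.mom z) : L.totalAct g (L.totalAct (𝓗.inv g) z) = z := by
  have h_inv : 𝓗.s (𝓗.inv g) = L.mom z := (𝓗.s_inv g).trans h
  rw [L.totalAct_eq (L.mom_totalAct_inv h).symm,
    L.act_congr rfl (L.totalAct_eq h_inv) _ ((𝓗.r_inv g).symm.trans (L.mom_act _ _ h_inv).symm),
    ← L.mul_act g (𝓗.inv g) z (𝓗.r_inv g).symm h_inv, L.act_of_eq_one (𝓗.mul_inv g)]

variable [TopologicalSpace Z]

theorem LeftAction.IsContinuous.continuousOn_totalAct {L : LeftAction 𝓗 Z}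
    (hL : L.IsContinuous) :
    ContinuousOn (fun a : H × Z => L.totalAct a.1 a.2) {a | 𝓗.s a.1 = L.mom a.2} := by
  rw [continuousOn_iff_continuous_domRestrict]
  exact hL.act.congr fun a => (L.totalAct_eq a.2).symm

theorem LeftAction.IsContinuous.exists_isCompact_forall_mem [T2Space V] {L : LeftAction 𝓗 Z}
    (hL : L.IsContinuous) {K : Set H} {C : Set Z} (hK : IsCompact K) (hC : IsCompact C) :
    ∃ M : Set Z, IsCompact M ∧
      ∀ g z, 𝓗.r g = L.mom z → g ∈ K → L.totalAct (𝓗.inv g) z ∈ C → z ∈ M := by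
  have hclosed : IsClosed {a : H × Z | 𝓗.s a.1 = L.mom a.2} :=
    isClosed_eq (𝓗.continuous_s.comp continuous_fst) (hL.mom.comp continuous_snd)
  refine ⟨_, ((hK.prod hC).inter_right hclosed).image_of_continuousOn
    (hL.continuousOn_totalAct.mono Set.inter_subset_right), fun g z h hg hz => ?_⟩
  exact ⟨(g, L.totalAct (𝓗.inv g) z), ⟨⟨hg, hz⟩, (L.mom_totalAct_inv h).symm⟩,
    L.totalAct_totalAct_inv h⟩

namespace RightAction

variable {R : RightAction 𝓗 Z}

theorem IsContinuous.continuousOn_totalAct (hR : R.IsContinuous) :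
    ContinuousOn (fun a : Z × H => R.totalAct a.1 a.2) {a | R.mom a.1 = 𝓗.r a.2} := by
  rw [continuousOn_iff_continuous_domRestrict]
  exact hR.act.congr fun a => (R.totalAct_eq a.2).symm

theorem IsContinuous.continuousOn_totalAct_right (hR : R.IsContinuous) (z : Z) :
    ContinuousOn (R.totalAct z) (𝓗.r ⁻¹' {R.mom z}) :=
  hR.continuousOn_totalAct.comp (by fun_prop : ContinuousOn (fun g => (z, g)) _)
    fun _ hg => Eq.symm hg

theorem IsProper.exists_isCompact_forall_act_mem (hR : R.IsProper) {C₁ C₂ : Set Z}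
    (h₁ : IsCompact C₁) (h₂ : IsCompact C₂) :
    ∃ L : Set H, IsCompact L ∧
      ∀ x g (h : R.mom x = 𝓗.r g), x ∈ C₁ → R.act x g h ∈ C₂ → g ∈ L :=
  ⟨(fun a : R.Trans => a.1.2) '' _,
    (IsProperMap.isCompact_preimage hR (h₁.prod h₂)).image (by fun_prop),
    fun x g h hx hxg => ⟨⟨(x, g), h⟩, ⟨hx, hxg⟩, rfl⟩⟩

theorem IsContinuous.isProper_of_forall_exists_isCompact [T2Space V] [T2Space Z]
    [LocallyCompactSpace Z] (hR : R.IsContinuous)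
    (h : ∀ C₁ C₂ : Set Z, IsCompact C₁ → IsCompact C₂ → ∃ L : Set H, IsCompact L ∧
      ∀ x g (h : R.mom x = 𝓗.r g), x ∈ C₁ → R.act x g h ∈ C₂ → g ∈ L) :
    R.IsProper := by
  have hcont : Continuous fun p : R.Trans => ((p.1.1, R.act p.1.1 p.1.2 p.2) : Z × Z) :=
    (continuous_fst.comp continuous_subtype_val).prodMk hR.act
  refine isProperMap_iff_isCompact_preimage.2 ⟨hcont, fun K hK => ?_⟩
  obtain ⟨L, hL, hL_mem⟩ := h _ _ (hK.image continuous_fst) (hK.image continuous_snd)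
  have hclosed : IsClosed {p : Z × H | R.mom p.1 = 𝓗.r p.2} :=
    isClosed_eq (hR.mom.comp continuous_fst) (𝓗.continuous_r.comp continuous_snd)
  have hcompact : IsCompact (Subtype.val ⁻¹' ((Prod.fst '' K) ×ˢ L) : Set R.Trans) :=
    hclosed.isClosedEmbedding_subtypeVal.isCompact_preimage ((hK.image continuous_fst).prod hL)
  refine hcompact.of_isClosed_subset (hK.isClosed.preimage hcont) fun p hp => ?_
  have hpK : p.1.1 ∈ Prod.fst '' K := ⟨_, hp, rfl⟩
  exact ⟨hpK, hL_mem _ _ p.2 hpK ⟨_, hp, rfl⟩⟩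

end RightAction

end TotalActions

section QuotientMaps

variable {Z Ω : Type*} [TopologicalSpace Z] [TopologicalSpace Ω]

theorem continuousOn_of_isOpenQuotientMap_comp {W : Type*} [TopologicalSpace W] {π : Z → Ω}
    (hπ : IsOpenQuotientMap π) {f : Ω → W} {S : Set Ω}
    (hf : ContinuousOn (fun z => f (π z)) (π ⁻¹' S)) : ContinuousOn f S := by
  rw [continuousOn_iff_continuous_domRestrict] at hf ⊢
  exact (hπ.restrictPreimage S).continuous_comp_iff.1 hf

theorem exists_isCompact_subset_image [WeaklyLocallyCompactSpace Z] {π : Z → Ω}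
    (hπ : IsOpenQuotientMap π) {K : Set Ω} (hK : IsCompact K) :
    ∃ C : Set Z, IsCompact C ∧ K ⊆ π '' C := by
  choose σ hσ using hπ.surjective
  choose N hN_compact hN_nhds using fun z : Z => exists_compact_mem_nhds z
  have himage : ∀ ω ∈ K, π '' N (σ ω) ∈ 𝓝 ω := fun ω _ => by
    simpa only [hσ] using hπ.isOpenMap.image_mem_nhds (hN_nhds (σ ω))
  obtain ⟨t, -, hKt⟩ := hK.elim_nhds_subcover _ himage
  refine ⟨⋃ ω ∈ t, N (σ ω), t.isCompact_biUnion fun ω _ => hN_compact _, fun ω hω => ?_⟩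
  obtain ⟨i, hi, z, hz, rfl⟩ := Set.mem_iUnion₂.1 (hKt hω)
  exact ⟨z, Set.mem_biUnion hi hz, rfl⟩

/-- The support of `F` meets the preimage of every compact set in a relatively compact set: the
condition under which `F` can be integrated over the fibres of `π`. -/
def HasFibrewiseCompactSupport (π : Z → Ω) (F : Z → ℝ) : Prop :=
  ∀ K : Set Ω, IsCompact K → ∃ C : Set Z, IsCompact C ∧ ∀ z, π z ∈ K → F z ≠ 0 → z ∈ C

theorem HasFibrewiseCompactSupport.mono {π : Z → Ω} {F F' : Z → ℝ}
    (hF : HasFibrewiseCompactSupport π F) (h : ∀ z, F' z ≠ 0 → F z ≠ 0) :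
    HasFibrewiseCompactSupport π F' := fun K hK =>
  let ⟨C, hC, hFC⟩ := hF K hK
  ⟨C, hC, fun z hz hz_ne => hFC z hz (h z hz_ne)⟩

theorem hasFibrewiseCompactSupport_finsum {ι : Type*} {π : Z → Ω} {ρ : ι → Ω → ℝ}
    (hρ : LocallyFinite fun i => Function.support (ρ i)) (f : ι → C_c(Z, ℝ)) :
    HasFibrewiseCompactSupport π fun z => ∑ᶠ i, ρ i (π z) * f i z := fun K hK => by
  have hfin := hρ.finite_nonempty_inter_compact hK
  refine ⟨⋃ i ∈ hfin.toFinset, tsupport (f i),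
    hfin.toFinset.isCompact_biUnion fun i _ => (f i).hasCompactSupport, fun z hz hsum => ?_⟩
  obtain ⟨i, hi⟩ : ∃ i, ρ i (π z) * f i z ≠ 0 := by
    by_contra! h
    exact hsum ((finsum_congr h).trans finsum_zero)
  exact Set.mem_biUnion (hfin.mem_toFinset.2 ⟨π z, left_ne_zero_of_mul hi, hz⟩)
    (subset_tsupport _ (right_ne_zero_of_mul hi))

theorem exists_continuous_nonneg_hasFibrewiseCompactSupport [T2Space Z] [LocallyCompactSpace Z]
    [T2Space Ω] [ParacompactSpace Ω] {π : Z → Ω} (hπ : IsOpenQuotientMap π) :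
    ∃ φ : Z → ℝ, Continuous φ ∧ (∀ z, 0 ≤ φ z) ∧ HasFibrewiseCompactSupport π φ ∧
      ∀ ω, ∃ z, π z = ω ∧ φ z ≠ 0 := by
  have := hπ.locallyCompactSpace
  choose σ hσ using hπ.surjective
  choose f hf_one hf_mem _ using fun z : Z =>
    exists_compactlySupported_eq_one (isCompact_singleton (x := z)) isOpen_univ (Set.subset_univ _)
  let W : Ω → Set Ω := fun ω => π '' Function.support (f (σ ω))
  have hW_open : ∀ ω, IsOpen (W ω) := fun ω =>
    hπ.isOpenMap _ (f (σ ω)).continuous.isOpen_support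
  have hW_cover : Set.univ ⊆ ⋃ ω, W ω := fun ω _ =>
    Set.mem_iUnion.2 ⟨ω, σ ω, by simp [hf_one (σ ω) _ rfl], hσ ω⟩
  obtain ⟨ρ, hρ⟩ := PartitionOfUnity.exists_isSubordinate isClosed_univ W hW_open hW_cover
  have hfinite : LocallyFinite fun ω => Function.support fun z => ρ ω (π z) * f (σ ω) z :=
    (ρ.locallyFinite.preimage_continuous hπ.continuous).subset fun _ _ => left_ne_zero_of_mul
  have hnonneg : ∀ z ω, 0 ≤ ρ ω (π z) * f (σ ω) z := fun z ω =>
    mul_nonneg (ρ.nonneg ω _) (hf_mem _ _).1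
  refine ⟨fun z => ∑ᶠ ω, ρ ω (π z) * f (σ ω) z,
    continuous_finsum (fun ω => ((ρ ω).continuous.comp hπ.continuous).mul (f (σ ω)).continuous)
      hfinite, fun z => finsum_nonneg (hnonneg z),
    hasFibrewiseCompactSupport_finsum ρ.locallyFinite _, fun ω => ?_⟩
  obtain ⟨i, hi⟩ := ρ.exists_pos (Set.mem_univ ω)
  obtain ⟨z, hz, rfl⟩ := hρ i (subset_tsupport _ hi.ne')
  exact ⟨z, rfl, ((mul_pos hi ((hf_mem _ _).1.lt_of_ne' hz)).trans_le
    (single_le_finsum i (hfinite.point_finite z) (hnonneg z))).ne'⟩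

end QuotientMaps

section OrbitMaps

variable {H V Z Ω : Type*} [TopologicalSpace H] [TopologicalSpace V] [TopologicalSpace Z]
  [TopologicalSpace Ω]

/-- The map `π` is an open quotient map whose fibres are the orbits of the action `R`. -/
structure RightAction.IsOrbitMap {𝓗 : TopGroupoid H V} (R : RightAction 𝓗 Z) (π : Z → Ω) :
    Prop where
  isOpenQuotientMap : IsOpenQuotientMap π
  eq_iff : ∀ z w, π z = π w ↔ ∃ (g : H) (h : R.mom z = 𝓗.r g), w = R.act z g h

namespace RightAction

variable {𝓗 : TopGroupoid H V} {R : RightAction 𝓗 Z} {π : Z → Ω}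

theorem isOpenMap_of_isQuotientMap (hr : IsOpenMap 𝓗.r) (hR : R.IsContinuous)
    (hπ : IsQuotientMap π)
    (h : ∀ z w, π z = π w ↔ ∃ (g : H) (h : R.mom z = 𝓗.r g), w = R.act z g h) :
    IsOpenMap π := by
  intro W hW
  rw [← hπ.isOpen_preimage, isOpen_iff_mem_nhds]
  rintro z ⟨w, hw, hwz⟩
  obtain ⟨g, hg, rfl⟩ := (h z w).1 hwz.symm
  have hact := hR.continuousOn_totalAct (z, g) hg
    (hW.mem_nhds (show R.totalAct z g ∈ W by rwa [R.totalAct_eq hg]))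
  obtain ⟨A, hA, hAW⟩ := mem_nhdsWithin_iff_exists_mem_nhds_inter.1 (Filter.mem_map.1 hact)
  obtain ⟨N₁, hN₁, N₂, hN₂, hNA⟩ := mem_nhds_prod_iff.1 hA
  have hrN₂ : 𝓗.r '' N₂ ∈ 𝓝 (R.mom z) := hg ▸ hr.image_mem_nhds hN₂
  filter_upwards [hN₁, hR.mom.continuousAt hrN₂] with y hy ⟨γ, hγ, hγy⟩
  exact ⟨R.totalAct y γ, @hAW (y, γ) ⟨hNA ⟨hy, hγ⟩, hγy.symm⟩,
    ((h _ _).2 ⟨γ, hγy.symm, R.totalAct_eq _⟩).symm⟩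

namespace IsOrbitMap

theorem apply_act (hπ : R.IsOrbitMap π) (z : Z) (g : H) (h : R.mom z = 𝓗.r g) :
    π (R.act z g h) = π z :=
  ((hπ.eq_iff _ _).2 ⟨g, h, rfl⟩).symm

theorem apply_totalAct (hπ : R.IsOrbitMap π) (z : Z) (g : H) : π (R.totalAct z g) = π z := by
  by_cases h : R.mom z = 𝓗.r g
  · rw [R.totalAct_eq h, hπ.apply_act]
  · rw [totalAct, dif_neg h]

theorem t2Space (hπ : R.IsOrbitMap π) (hP : R.IsProper) : T2Space Ω := by
  rw [t2Space_iff_of_isOpenQuotientMap hπ.isOpenQuotientMap]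
  convert IsProperMap.isClosedMap hP |>.isClosed_range using 1
  ext ⟨z, w⟩
  refine (hπ.eq_iff z w).trans ⟨?_, ?_⟩
  · rintro ⟨g, h, rfl⟩
    exact ⟨⟨(z, g), h⟩, rfl⟩
  · rintro ⟨⟨⟨z', g⟩, h⟩, heq⟩
    obtain ⟨rfl, rfl⟩ := Prod.mk.inj heq
    exact ⟨g, h, rfl⟩

theorem exists_isCompact_forall_mem (hπ : R.IsOrbitMap π) (hP : R.IsProper) {F : Z → ℝ}
    (hF : HasFibrewiseCompactSupport π F) {N : Set Z} (hN : IsCompact N) :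
    ∃ K : Set H, IsCompact K ∧
      ∀ z ∈ N, ∀ g, 𝓗.r g = R.mom z → F (R.totalAct z g) ≠ 0 → g ∈ K := by
  obtain ⟨C, hC, hFC⟩ := hF _ (hN.image hπ.isOpenQuotientMap.continuous)
  obtain ⟨K, hK, hK_mem⟩ := hP.exists_isCompact_forall_act_mem hN hC
  refine ⟨K, hK, fun z hz g hg hFz => hK_mem z g hg.symm hz ?_⟩
  rw [← R.totalAct_eq]
  exact hFC _ ⟨z, hz, (hπ.apply_totalAct z g).symm⟩ hFz

theorem exists_isCompact_arrows (hπ : R.IsOrbitMap π) (hP : R.IsProper) {F : Z → ℝ}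
    (hF : HasFibrewiseCompactSupport π F) (z : Z) :
    ∃ K : Set H, IsCompact K ∧ ∀ g, 𝓗.r g = R.mom z → F (R.totalAct z g) ≠ 0 → g ∈ K := by
  simpa using hπ.exists_isCompact_forall_mem hP hF (isCompact_singleton (x := z))

theorem exists_nhds_isCompact_arrows [WeaklyLocallyCompactSpace Z] (hπ : R.IsOrbitMap π)
    (hP : R.IsProper) {F : Z → ℝ} (hF : HasFibrewiseCompactSupport π F) {T : Type*}
    [TopologicalSpace T] {ζ : T → Z} (hζ : Continuous ζ) (t₀ : T) :
    ∃ N ∈ 𝓝 t₀, ∃ K : Set H, IsCompact K ∧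
      ∀ t ∈ N, ∀ g, 𝓗.r g = R.mom (ζ t) → F (R.totalAct (ζ t) g) ≠ 0 → g ∈ K := by
  obtain ⟨N, hN, hN_nhds⟩ := exists_compact_mem_nhds (ζ t₀)
  obtain ⟨K, hK, hK_mem⟩ := hπ.exists_isCompact_forall_mem hP hF hN
  exact ⟨ζ ⁻¹' N, hζ.continuousAt hN_nhds, K, hK, fun t ht => hK_mem (ζ t) ht⟩

end IsOrbitMap

end RightAction

end OrbitMaps

section OrbitIntegral

variable {H V Z Ω : Type*} [TopologicalSpace H] [TopologicalSpace V] [MeasurableSpace H]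
  {𝓗 : HaarGroupoid H V} {R : RightAction 𝓗.toTopGroupoid Z}

variable (𝓗 R) in
/-- The integral `∫ F(zg) dα^{mom z}(g)` of a function over the orbit of `z`, for an arbitrary
right action. -/
def integralOverOrbit (F : Z → ℝ) (z : Z) : ℝ := ∫ g, F (R.totalAct z g) ∂𝓗.haar (R.mom z)

theorem integralOverOrbit_mul_comp [TopologicalSpace Z] [TopologicalSpace Ω] {π : Z → Ω}
    (hπ : R.IsOrbitMap π) (F : Z → ℝ) (k : Ω → ℝ) (z : Z) :
    integralOverOrbit 𝓗 R (fun w => F w * k (π w)) z = integralOverOrbit 𝓗 R F z * k (π z) := by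
  simp only [integralOverOrbit, hπ.apply_totalAct, integral_mul_const]

section

variable [T2Space H] [LocallyCompactSpace H]

theorem integralOverOrbit_act {F : Z → ℝ} {z : Z}
    (hF : ContinuousOn (fun g => F (R.totalAct z g)) (𝓗.r ⁻¹' {R.mom z})) {K : Set H}
    (hK : IsCompact K) (hFK : ∀ g, 𝓗.r g = R.mom z → F (R.totalAct z g) ≠ 0 → g ∈ K) (g : H)
    (h : R.mom z = 𝓗.r g) :
    integralOverOrbit 𝓗 R F (R.act z g h) = integralOverOrbit 𝓗 R F z := by
  have := 𝓗.t2Space_units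
  obtain ⟨f, hf⟩ := exists_compactlySupported_eqOn (isClosed_singleton.preimage 𝓗.continuous_r)
    hK hF hFK
  have hfz : integralOverOrbit 𝓗 R F z = ∫ x, f x ∂𝓗.haar (𝓗.r g) := by
    rw [integralOverOrbit, ← h]
    exact 𝓗.haar_family.integral_congr fun x hx => (hf hx).symm
  rw [hfz, ← 𝓗.haar_invariant g f, integralOverOrbit, R.mom_act]
  refine 𝓗.haar_family.integral_congr fun x hx => ?_
  rw [dif_pos hx.symm, hf ((𝓗.r_mul _ _ _).trans h.symm), R.totalAct_act]

theorem integralOverOrbit_pos [BorelSpace H] {F : Z → ℝ} {z : Z}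
    (hF : ContinuousOn (fun g => F (R.totalAct z g)) (𝓗.r ⁻¹' {R.mom z})) {K : Set H}
    (hK : IsCompact K) (hFK : ∀ g, 𝓗.r g = R.mom z → F (R.totalAct z g) ≠ 0 → g ∈ K)
    (hF_nonneg : ∀ g, 𝓗.r g = R.mom z → 0 ≤ F (R.totalAct z g))
    (hF_ne : ∃ g, 𝓗.r g = R.mom z ∧ F (R.totalAct z g) ≠ 0) : 0 < integralOverOrbit 𝓗 R F z := by
  have := 𝓗.t2Space_units
  obtain ⟨g, hg, hFg⟩ := hF_ne
  obtain ⟨f, hf⟩ := exists_compactlySupported_eqOn (isClosed_singleton.preimage 𝓗.continuous_r)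
    hK hF hFK
  have hf_nonneg : ∀ᵐ x ∂𝓗.haar (R.mom z), 0 ≤ f x :=
    (𝓗.haar_family.ae_eq _).mono fun x hx => (hF_nonneg x hx).trans_eq (hf hx).symm
  calc 0 < ∫ x, f x ∂𝓗.haar (R.mom z) := by
        rw [integral_pos_iff_support_of_nonneg_ae hf_nonneg
          (𝓗.haar_family.integrable_compactlySupported f _)]
        exact 𝓗.haar_full _ _ f.continuous.isOpen_support ⟨g, (hf hg).trans_ne hFg, hg⟩
    _ = integralOverOrbit 𝓗 R F z := 𝓗.haar_family.integral_congr fun x hx => hf hx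

variable [TopologicalSpace Z] [TopologicalSpace Ω] {π : Z → Ω}

theorem integralOverOrbit_eq_of_continuousOn (hπ : R.IsOrbitMap π) {F : Z → ℝ} {z w : Z}
    (hF : ContinuousOn (fun g => F (R.totalAct z g)) (𝓗.r ⁻¹' {R.mom z})) {K : Set H}
    (hK : IsCompact K) (hFK : ∀ g, 𝓗.r g = R.mom z → F (R.totalAct z g) ≠ 0 → g ∈ K)
    (hzw : π z = π w) : integralOverOrbit 𝓗 R F z = integralOverOrbit 𝓗 R F w := by
  obtain ⟨g, hg, rfl⟩ := (hπ.eq_iff _ _).1 hzw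
  exact (integralOverOrbit_act hF hK hFK g hg).symm

variable {F : Z → ℝ}

theorem integralOverOrbit_eq (hR : R.IsContinuous) (hP : R.IsProper) (hπ : R.IsOrbitMap π)
    (hF : Continuous F) (hF_supp : HasFibrewiseCompactSupport π F) {z w : Z} (hzw : π z = π w) :
    integralOverOrbit 𝓗 R F z = integralOverOrbit 𝓗 R F w := by
  obtain ⟨K, hK, hK_mem⟩ := hπ.exists_isCompact_arrows hP hF_supp z
  exact integralOverOrbit_eq_of_continuousOn hπ
    (hF.comp_continuousOn (hR.continuousOn_totalAct_right z)) hK hK_mem hzw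

variable [BorelSpace H]

theorem continuous_integralOverOrbit [WeaklyLocallyCompactSpace Z] (hR : R.IsContinuous)
    (hP : R.IsProper) (hπ : R.IsOrbitMap π) (hF : Continuous F)
    (hF_supp : HasFibrewiseCompactSupport π F) : Continuous (integralOverOrbit 𝓗 R F) := by
  have := 𝓗.t2Space_units
  refine 𝓗.haar_family.continuous_fibre_integral 𝓗.continuous_r hR.mom ?_
    (hπ.exists_nhds_isCompact_arrows hP hF_supp continuous_id)
  exact hF.comp_continuousOn (hR.continuousOn_totalAct.mono fun a ha => Eq.symm ha)

end

/-- A cutoff function for the orbit map of a groupoid action: multiplication by `φ` followed by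
integration over the orbits is a right inverse to pulling back functions along `π`. -/
structure IsCutoff [TopologicalSpace Z] [TopologicalSpace Ω] (𝓗 : HaarGroupoid H V)
    (R : RightAction 𝓗.toTopGroupoid Z) (π : Z → Ω) (φ : Z → ℝ) : Prop where
  continuous : Continuous φ
  nonneg : ∀ z, 0 ≤ φ z
  hasFibrewiseCompactSupport : HasFibrewiseCompactSupport π φ
  integralOverOrbit_eq_one : ∀ z, integralOverOrbit 𝓗 R φ z = 1

theorem exists_isCutoff [T2Space H] [LocallyCompactSpace H] [BorelSpace H] [TopologicalSpace Z]
    [T2Space Z] [LocallyCompactSpace Z] [TopologicalSpace Ω] [ParacompactSpace Ω]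
    (hR : R.IsContinuous) (hP : R.IsProper) {π : Z → Ω} (hπ : R.IsOrbitMap π) :
    ∃ φ, IsCutoff 𝓗 R π φ := by
  have := hπ.t2Space hP
  obtain ⟨φ, hφ, hφ_nonneg, hφ_supp, hφ_ne⟩ :=
    exists_continuous_nonneg_hasFibrewiseCompactSupport hπ.isOpenQuotientMap
  have hpos : ∀ z, 0 < integralOverOrbit 𝓗 R φ z := fun z => by
    obtain ⟨w, hw, hφw⟩ := hφ_ne (π z)
    obtain ⟨g, hg, rfl⟩ := (hπ.eq_iff z w).1 hw.symm
    obtain ⟨K, hK, hK_mem⟩ := hπ.exists_isCompact_arrows hP hφ_supp z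
    exact integralOverOrbit_pos (hφ.comp_continuousOn (hR.continuousOn_totalAct_right z)) hK hK_mem
      (fun _ _ => hφ_nonneg _) ⟨g, hg.symm, by rwa [R.totalAct_eq hg]⟩
  have hcont := continuous_integralOverOrbit hR hP hπ hφ hφ_supp
  choose σ hσ using hπ.isOpenQuotientMap.surjective
  have hσπ : ∀ z, integralOverOrbit 𝓗 R φ (σ (π z)) = integralOverOrbit 𝓗 R φ z := fun z =>
    integralOverOrbit_eq hR hP hπ hφ hφ_supp (hσ (π z))
  refine ⟨fun z => φ z * (integralOverOrbit 𝓗 R φ z)⁻¹,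
    hφ.mul (hcont.inv₀ fun z => (hpos z).ne'),
    fun z => mul_nonneg (hφ_nonneg z) (inv_nonneg.2 (hpos z).le),
    hφ_supp.mono fun _ => left_ne_zero_of_mul, fun z => ?_⟩
  have hmul := integralOverOrbit_mul_comp hπ φ (fun ω => (integralOverOrbit 𝓗 R φ (σ ω))⁻¹) z
  simp only [hσπ] at hmul
  rw [hmul, mul_inv_cancel₀ (hpos z).ne']

end OrbitIntegral


section Composite

variable {G₁ U₁ G₂ U₂ G₃ U₃ X Y : Type*}
  [TopologicalSpace G₁] [TopologicalSpace U₁] [TopologicalSpace G₂] [TopologicalSpace U₂]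
  [TopologicalSpace G₃] [TopologicalSpace U₃]
  {𝓖₁ : TopGroupoid G₁ U₁} {𝓖₂ : TopGroupoid G₂ U₂} {𝓖₃ : TopGroupoid G₃ U₃}
  (A : Bispace 𝓖₁ 𝓖₂ X) (B : Bispace 𝓖₂ 𝓖₃ Y)

namespace FibreProd

/-- The diagonal action `(x, y)γ = (xγ, γ⁻¹y)` of `G₂`, as a right action. -/
def diagAction : RightAction 𝓖₂ (FibreProd A B) where
  mom := mom
  act := diag
  mom_act _ _ _ := A.right.mom_act _ _ _
  act_one z := ext' (A.right.act_of_eq_one rfl _) (B.left.act_of_eq_one (𝓖₂.inv_one _) _)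
  act_mul z g g' h hg := by
    refine ext' (A.right.act_mul z.fst g g' h hg) ?_
    have hab : 𝓖₂.s (𝓖₂.inv g') = 𝓖₂.r (𝓖₂.inv g) :=
      (𝓖₂.s_inv g').trans (hg.symm.trans (𝓖₂.r_inv g).symm)
    refine Eq.trans ?_ (B.left.mul_act (𝓖₂.inv g') (𝓖₂.inv g) z.snd hab (z.s_inv_eq g h))
    exact B.left.act_congr (𝓖₂.inv_mul_rev g g' hg) rfl _ _

/-- The action `η(x, y) = (ηx, y)` of `G₁` on the fibre product. -/
def leftAction : LeftAction 𝓖₁ (FibreProd A B) where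
  mom z := A.left.mom z.fst
  act := leftAct
  mom_act _ _ _ := A.left.mom_act _ _ _
  one_act _ := ext' (A.left.one_act _) rfl
  mul_act _ _ _ hab h := ext' (A.left.mul_act _ _ _ hab h) rfl

/-- The action `(x, y)η = (x, yη)` of `G₃` on the fibre product. -/
def rightAction : RightAction 𝓖₃ (FibreProd A B) where
  mom z := B.right.mom z.snd
  act := rightAct
  mom_act _ _ _ := B.right.mom_act _ _ _
  act_one _ := ext' rfl (B.right.act_one _)
  act_mul _ _ _ h hab := ext' rfl (B.right.act_mul _ _ _ h hab)

variable {A B}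

theorem proj_leftAction_totalAct (g : G₁) (z : FibreProd A B) :
    OrbitSpace.proj ((leftAction A B).totalAct g z) =
      OrbitSpace.leftActAux g (OrbitSpace.proj z) := by
  by_cases h : 𝓖₁.s g = A.left.mom z.fst
  · rw [OrbitSpace.leftActAux_proj g z h, (leftAction A B).totalAct_eq h]; rfl
  · have h_proj : OrbitSpace.leftActAux g (OrbitSpace.proj z) = OrbitSpace.proj z := dif_neg h
    exact (congrArg _ (dif_neg h)).trans h_proj.symm

theorem proj_rightAction_totalAct (z : FibreProd A B) (g : G₃) :
    OrbitSpace.proj ((rightAction A B).totalAct z g) =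
      OrbitSpace.rightActAux (OrbitSpace.proj z) g := by
  by_cases h : B.right.mom z.snd = 𝓖₃.r g
  · rw [OrbitSpace.rightActAux_proj z g h, (rightAction A B).totalAct_eq h]; rfl
  · have h_proj : OrbitSpace.rightActAux (OrbitSpace.proj z) g = OrbitSpace.proj z := dif_neg h
    exact (congrArg _ (dif_neg h)).trans h_proj.symm

variable [TopologicalSpace X] [TopologicalSpace Y]

protected theorem continuous_fst : Continuous (fst : FibreProd A B → X) :=
  continuous_fst.comp continuous_subtype_val

protected theorem continuous_snd : Continuous (snd : FibreProd A B → Y) :=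
  continuous_snd.comp continuous_subtype_val

instance [T2Space X] [T2Space Y] : T2Space (FibreProd A B) :=
  inferInstanceAs (T2Space {p : X × Y // A.right.mom p.1 = B.left.mom p.2})

theorem isClosed_setOf_mom_eq [T2Space U₂] (hA : A.right.IsContinuous) (hB : B.left.IsContinuous) :
    IsClosed {p : X × Y | A.right.mom p.1 = B.left.mom p.2} :=
  isClosed_eq (hA.mom.comp continuous_fst) (hB.mom.comp continuous_snd)

theorem locallyCompactSpace [T2Space U₂] [LocallyCompactSpace X] [LocallyCompactSpace Y]
    (hA : A.right.IsContinuous) (hB : B.left.IsContinuous) :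
    LocallyCompactSpace (FibreProd A B) :=
  (isClosed_setOf_mom_eq hA hB).isClosedEmbedding_subtypeVal.locallyCompactSpace

theorem continuous_mk {T : Type*} [TopologicalSpace T] {f : T → FibreProd A B}
    (h₁ : Continuous fun t => (f t).fst) (h₂ : Continuous fun t => (f t).snd) : Continuous f :=
  continuous_induced_rng.2 (h₁.prodMk h₂)

theorem diagAction_isContinuous (hA : A.right.IsContinuous) (hB : B.left.IsContinuous) :
    (diagAction A B).IsContinuous where
  mom := hA.mom.comp FibreProd.continuous_fst
  act := by
    refine continuous_mk ?_ ?_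
    · refine (hA.act.comp (f := fun p : (diagAction A B).Trans =>
        (⟨(p.1.1.fst, p.1.2), p.2⟩ : A.right.Trans)) ?_)
      exact Continuous.subtype_mk
        ((FibreProd.continuous_fst.comp (by fun_prop)).prodMk (by fun_prop)) _
    · refine (hB.act.comp (f := fun p : (diagAction A B).Trans =>
        (⟨(𝓖₂.inv p.1.2, p.1.1.snd), p.1.1.s_inv_eq p.1.2 p.2⟩ : B.left.Trans)) ?_)
      exact Continuous.subtype_mk ((𝓖₂.continuous_inv.comp (by fun_prop)).prodMk
        (FibreProd.continuous_snd.comp (by fun_prop))) _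

theorem leftAction_isContinuous (hA : A.left.IsContinuous) :
    (leftAction A B).IsContinuous where
  mom := hA.mom.comp FibreProd.continuous_fst
  act := by
    have h : Continuous fun p : (leftAction A B).Trans => p.1.2.snd :=
      FibreProd.continuous_snd.comp (continuous_snd.comp continuous_subtype_val)
    refine continuous_mk ?_ h
    refine (hA.act.comp (f := fun p : (leftAction A B).Trans =>
        (⟨(p.1.1, p.1.2.fst), p.2⟩ : A.left.Trans)) ?_)
    exact Continuous.subtype_mk (Continuous.prodMk (by fun_prop)
      (FibreProd.continuous_fst.comp (by fun_prop))) _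

theorem rightAction_isContinuous (hB : B.right.IsContinuous) :
    (rightAction A B).IsContinuous where
  mom := hB.mom.comp FibreProd.continuous_snd
  act := by
    have h : Continuous fun p : (rightAction A B).Trans => p.1.1.fst :=
      FibreProd.continuous_fst.comp (continuous_fst.comp continuous_subtype_val)
    refine continuous_mk h ?_
    refine (hB.act.comp (f := fun p : (rightAction A B).Trans =>
        (⟨(p.1.1.snd, p.1.2), p.2⟩ : B.right.Trans)) ?_)
    exact Continuous.subtype_mk
        ((FibreProd.continuous_snd.comp (by fun_prop)).prodMk (by fun_prop)) _

theorem diagAction_isProper [T2Space X] [T2Space Y] [T2Space U₂] [LocallyCompactSpace X]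
    [LocallyCompactSpace Y] (hA : A.right.IsContinuous) (hB : B.left.IsContinuous)
    (hP : A.right.IsProper) : (diagAction A B).IsProper := by
  have := locallyCompactSpace hA hB
  refine (diagAction_isContinuous hA hB).isProper_of_forall_exists_isCompact
    fun C₁ C₂ h₁ h₂ => ?_
  obtain ⟨L, hL, hL_mem⟩ := hP.exists_isCompact_forall_act_mem (h₁.image FibreProd.continuous_fst)
    (h₂.image FibreProd.continuous_fst)
  exact ⟨L, hL, fun z g h hz hzg => hL_mem z.fst g h ⟨z, hz, rfl⟩ ⟨_, hzg, rfl⟩⟩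

theorem exists_isCompact_forall_snd_mem [T2Space U₂] (hB : B.left.IsContinuous)
    (hP : A.right.IsProper) {C₁ : Set X} {C₂ : Set (FibreProd A B)} (h₁ : IsCompact C₁)
    (h₂ : IsCompact C₂) :
    ∃ M : Set Y, IsCompact M ∧ ∀ (z : FibreProd A B) (g : G₂) (h : z.mom = 𝓖₂.r g),
      z.fst ∈ C₁ → z.diag g h ∈ C₂ → z.snd ∈ M := by
  obtain ⟨L, hL, hL_mem⟩ := hP.exists_isCompact_forall_act_mem h₁
    (h₂.image FibreProd.continuous_fst)
  obtain ⟨M, hM, hM_mem⟩ := hB.exists_isCompact_forall_mem hL (h₂.image FibreProd.continuous_snd)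
  refine ⟨M, hM, fun z g h hz hzg => ?_⟩
  refine hM_mem g z.snd (h.symm.trans z.2) (hL_mem z.fst g h hz ⟨_, hzg, rfl⟩) ?_
  rw [B.left.totalAct_eq (z.s_inv_eq g h)]
  exact ⟨_, hzg, rfl⟩

end FibreProd

namespace OrbitSpace

open FibreProd

variable {A B} [TopologicalSpace X] [TopologicalSpace Y]

theorem isQuotientMap_proj : IsQuotientMap (proj : FibreProd A B → OrbitSpace A B) :=
  isQuotientMap_quot_mk

theorem isOrbitMap_proj (hr : IsOpenMap 𝓖₂.r) (hA : A.right.IsContinuous)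
    (hB : B.left.IsContinuous) :
    (diagAction A B).IsOrbitMap (proj : FibreProd A B → OrbitSpace A B) where
  isOpenQuotientMap := ⟨proj_surjective, isQuotientMap_proj.continuous,
    RightAction.isOpenMap_of_isQuotientMap hr (diagAction_isContinuous hA hB) isQuotientMap_proj
      fun _ _ => proj_eq_iff⟩
  eq_iff _ _ := proj_eq_iff

theorem continuous_leftMom (hA : A.left.IsContinuous) :
    Continuous (leftMom : OrbitSpace A B → U₁) :=
  isQuotientMap_proj.continuous_iff.2 (hA.mom.comp FibreProd.continuous_fst)

theorem continuous_rightMom (hB : B.right.IsContinuous) :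
    Continuous (rightMom : OrbitSpace A B → U₃) :=
  isQuotientMap_proj.continuous_iff.2 (hB.mom.comp FibreProd.continuous_snd)

theorem continuousOn_leftActAux (hπ : IsOpenQuotientMap (proj : FibreProd A B → OrbitSpace A B))
    (hA : A.left.IsContinuous) :
    ContinuousOn (fun a : G₁ × OrbitSpace A B => leftActAux a.1 a.2)
      {a | 𝓖₁.s a.1 = leftMom a.2} := by
  refine continuousOn_of_isOpenQuotientMap_comp (IsOpenQuotientMap.prodMap .id hπ) ?_
  simp only [Prod.map_fst, Prod.map_snd, id, ← proj_leftAction_totalAct]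
  exact hπ.continuous.comp_continuousOn (leftAction_isContinuous hA).continuousOn_totalAct

theorem continuousOn_rightActAux (hπ : IsOpenQuotientMap (proj : FibreProd A B → OrbitSpace A B))
    (hB : B.right.IsContinuous) :
    ContinuousOn (fun a : OrbitSpace A B × G₃ => rightActAux a.1 a.2)
      {a | rightMom a.1 = 𝓖₃.r a.2} := by
  refine continuousOn_of_isOpenQuotientMap_comp (IsOpenQuotientMap.prodMap hπ .id) ?_
  simp only [Prod.map_fst, Prod.map_snd, id, ← proj_rightAction_totalAct]
  exact hπ.continuous.comp_continuousOn (rightAction_isContinuous hB).continuousOn_totalAct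

theorem bispace_left_isContinuous
    (hπ : IsOpenQuotientMap (proj : FibreProd A B → OrbitSpace A B))
    (hA : A.left.IsContinuous) : (bispace A B).left.IsContinuous where
  mom := continuous_leftMom hA
  act := (continuousOn_leftActAux hπ hA).domRestrict

theorem bispace_right_isContinuous
    (hπ : IsOpenQuotientMap (proj : FibreProd A B → OrbitSpace A B))
    (hB : B.right.IsContinuous) : (bispace A B).right.IsContinuous where
  mom := continuous_rightMom hB
  act := (continuousOn_rightActAux hπ hB).domRestrict

theorem bispace_right_isProper [T2Space X] [T2Space Y] [LocallyCompactSpace X]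
    [LocallyCompactSpace Y] [T2Space U₂] [T2Space U₃] (hr : IsOpenMap 𝓖₂.r)
    (hA : A.right.IsContinuous) (hB : B.left.IsContinuous) (hB' : B.right.IsContinuous)
    (hP : A.right.IsProper) (hP' : B.right.IsProper) : (bispace A B).right.IsProper := by
  have := locallyCompactSpace hA hB
  have hπ := isOrbitMap_proj hr hA hB
  have := hπ.t2Space (diagAction_isProper hA hB hP)
  have := hπ.isOpenQuotientMap.locallyCompactSpace
  refine (bispace_right_isContinuous hπ.isOpenQuotientMap hB').isProper_of_forall_exists_isCompact
    fun K₁ K₂ h₁ h₂ => ?_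
  obtain ⟨C₁, hC₁, hK₁⟩ := exists_isCompact_subset_image hπ.isOpenQuotientMap h₁
  obtain ⟨C₂, hC₂, hK₂⟩ := exists_isCompact_subset_image hπ.isOpenQuotientMap h₂
  obtain ⟨M, hM, hM_mem⟩ := exists_isCompact_forall_snd_mem hB hP
    (hC₁.image FibreProd.continuous_fst) hC₂
  obtain ⟨L, hL, hL_mem⟩ := hP'.exists_isCompact_forall_act_mem
    (hC₁.image FibreProd.continuous_snd) hM
  refine ⟨L, hL, fun ω c h hω hωc => ?_⟩
  obtain ⟨z, hz, rfl⟩ := hK₁ hω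
  obtain ⟨w, hw, hwz⟩ := hK₂ hωc
  obtain ⟨g, hg, rfl⟩ := proj_eq_iff.1 ((rightActAux_proj z c h).symm.trans hwz.symm)
  exact hL_mem z.snd c h ⟨z, hz, rfl⟩ (hM_mem (rightAct z c h) g hg ⟨z, hz, rfl⟩ hw)

end OrbitSpace

end Composite


namespace IsCutoff

variable {H V Z Ω : Type*} [TopologicalSpace H] [TopologicalSpace V] [MeasurableSpace H]
  [TopologicalSpace Z] [TopologicalSpace Ω] {𝓗 : HaarGroupoid H V}
  {R : RightAction 𝓗.toTopGroupoid Z} {π : Z → Ω} {φ : Z → ℝ}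

theorem integralOverOrbit_mul_comp (hφ : IsCutoff 𝓗 R π φ) (hπ : R.IsOrbitMap π) (f : Ω → ℝ)
    (z : Z) : integralOverOrbit 𝓗 R (fun w => φ w * f (π w)) z = f (π z) := by
  rw [_root_.integralOverOrbit_mul_comp hπ, hφ.integralOverOrbit_eq_one, one_mul]

theorem hasCompactSupport_mul_comp [R1Space Z] (hφ : IsCutoff 𝓗 R π φ) {f : Ω → ℝ}
    (hf : HasCompactSupport f) : HasCompactSupport fun z => φ z * f (π z) := by
  obtain ⟨C, hC, hφC⟩ := hφ.hasFibrewiseCompactSupport _ hf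
  refine HasCompactSupport.of_support_subset_isCompact hC fun z hz => ?_
  exact hφC z (subset_tsupport _ (right_ne_zero_of_mul hz)) (left_ne_zero_of_mul hz)

/-- The function `φ · (f ∘ π)` on the total space, whose orbit integral is `f`: a cutoff function
`φ` provides a section of the integration over the orbits. -/
def lift [R1Space Z] (hφ : IsCutoff 𝓗 R π φ) (hπ : Continuous π) (f : C_c(Ω, ℝ)) : C_c(Z, ℝ) :=
  ⟨⟨fun z => φ z * f (π z), hφ.continuous.mul (f.continuous.comp hπ)⟩,
    hφ.hasCompactSupport_mul_comp f.hasCompactSupport⟩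

end IsCutoff

theorem RightAction.IsContinuous.exists_compactlySupported_comp_act {H V Z : Type*}
    [TopologicalSpace H] [TopologicalSpace V] [T2Space V] [TopologicalSpace Z] [T2Space Z]
    [LocallyCompactSpace Z] {𝓗 : TopGroupoid H V} {R : RightAction 𝓗 Z} (hR : R.IsContinuous)
    (c : H) (F : C_c(Z, ℝ)) :
    ∃ F' : C_c(Z, ℝ), ∀ z (h : R.mom z = 𝓗.r c), F' z = F (R.act z c h) := by
  have h_closed : ∀ v, IsClosed (R.mom ⁻¹' {v}) := fun v => isClosed_singleton.preimage hR.mom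
  have h_move : ∀ e : H, ContinuousOn (fun z => R.totalAct z e) (R.mom ⁻¹' {𝓗.r e}) := fun e =>
    hR.continuousOn_totalAct.comp (by fun_prop : ContinuousOn (fun z => (z, e)) _) fun z hz => hz
  have h_supp : IsCompact ((fun z => R.totalAct z (𝓗.inv c)) ''
      (tsupport F ∩ R.mom ⁻¹' {𝓗.r (𝓗.inv c)})) :=
    (F.hasCompactSupport.isCompact.inter_right (h_closed _)).image_of_continuousOn
      ((h_move _).mono Set.inter_subset_right)
  obtain ⟨F', hF'⟩ := exists_compactlySupported_eqOn (h_closed (𝓗.r c)) h_supp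
    (F.continuous.comp_continuousOn (h_move c)) fun z (hz : R.mom z = 𝓗.r c) hFz => by
      refine ⟨R.totalAct z c, ⟨subset_tsupport _ hFz, ?_⟩, ?_⟩
      · exact (congrArg R.mom (R.totalAct_eq hz)).trans ((R.mom_act _ _ _).trans (𝓗.r_inv c).symm)
      · change R.totalAct (R.totalAct z c) (𝓗.inv c) = z
        rw [R.totalAct_eq hz, R.totalAct_act hz (𝓗.r_inv c).symm,
          R.totalAct_eq (hz.trans (𝓗.r_mul _ _ _).symm), R.act_of_eq_one (𝓗.mul_inv c)]
  exact ⟨F', fun z hz => (hF' hz).trans (congrArg F (R.totalAct_eq hz))⟩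

section CompositeMeasures

open FibreProd OrbitSpace

variable {G₁ U₁ G₂ U₂ G₃ U₃ X Y : Type*}
  [TopologicalSpace G₁] [TopologicalSpace U₁] [TopologicalSpace G₂] [TopologicalSpace U₂]
  [TopologicalSpace G₃] [TopologicalSpace U₃]

section

variable {𝓖₁ : TopGroupoid G₁ U₁} {𝓖₂ : TopGroupoid G₂ U₂} {𝓖₃ : TopGroupoid G₃ U₃}
  {A : Bispace 𝓖₁ 𝓖₂ X} {B : Bispace 𝓖₂ 𝓖₃ Y}

open Classical in
/-- The extension by zero of a function on the fibre product to `X × Y`, in curried form, through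
which iterated integrals over the fibre product are expressed. -/
def FibreProd.extendByZero (F : FibreProd A B → ℝ) (x : X) (y : Y) : ℝ :=
  if h : A.right.mom x = B.left.mom y then F ⟨(x, y), h⟩ else 0

theorem FibreProd.extendByZero_eq (F : FibreProd A B → ℝ) {x : X} {y : Y}
    (h : A.right.mom x = B.left.mom y) : extendByZero F x y = F ⟨(x, y), h⟩ := dif_pos h

theorem FibreProd.continuousOn_extendByZero [TopologicalSpace X] [TopologicalSpace Y]
    {F : FibreProd A B → ℝ} (hF : Continuous F) :
    ContinuousOn (fun a : X × Y => extendByZero F a.1 a.2)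
      {a | A.right.mom a.1 = B.left.mom a.2} := by
  rw [continuousOn_iff_continuous_domRestrict]
  exact hF.congr fun a => (extendByZero_eq F a.2).symm

end

variable [TopologicalSpace X] [TopologicalSpace Y]
  [MeasurableSpace G₁] [MeasurableSpace G₂] [MeasurableSpace G₃]
  [MeasurableSpace X] [MeasurableSpace Y]
  {𝓖₁ : HaarGroupoid G₁ U₁} {𝓖₂ : HaarGroupoid G₂ U₂} {𝓖₃ : HaarGroupoid G₃ U₃}
  {𝒳 : TopologicalCorrespondence 𝓖₁ 𝓖₂ X} {𝒴 : TopologicalCorrespondence 𝓖₂ 𝓖₃ Y}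

theorem fibreProdIntegral_eq (u : U₃) (F : FibreProd 𝒳.toBispace 𝒴.toBispace → ℝ) :
    fibreProdIntegral 𝒳 𝒴 u F =
      ∫ y, ∫ x, extendByZero F x y ∂𝒳.lam (𝒴.left.mom y) ∂𝒴.lam u := rfl

theorem orbitIntegral_eq (F : FibreProd 𝒳.toBispace 𝒴.toBispace → ℝ)
    (ω : OrbitSpace 𝒳.toBispace 𝒴.toBispace) :
    orbitIntegral 𝒳 𝒴 F ω =
      integralOverOrbit 𝓖₂ (diagAction 𝒳.toBispace 𝒴.toBispace) F ω.rep := by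
  refine 𝓖₂.haar_family.integral_congr fun g hg => ?_
  rw [dif_pos hg.symm, (diagAction 𝒳.toBispace 𝒴.toBispace).totalAct_eq hg.symm]
  rfl

section Cochain

variable {b b' : FibreProd 𝒳.toBispace 𝒴.toBispace → ℝ}

theorem IsCompositeCochain.apply_diag (hb : IsCompositeCochain 𝒳 𝒴 b)
    (z : FibreProd 𝒳.toBispace 𝒴.toBispace) (g : G₂) (h : z.mom = 𝓖₂.r g) :
    b (z.diag g h) = 𝒴.adj ⟨(𝓖₂.inv g, z.snd), z.s_inv_eq g h⟩ * b z := by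
  rw [← hb.coboundary z g h, div_mul_cancel₀ _ (hb.pos z).ne']

theorem IsCompositeCochain.div_eq_of_proj_eq (hb : IsCompositeCochain 𝒳 𝒴 b)
    (hb' : IsCompositeCochain 𝒳 𝒴 b') {z w : FibreProd 𝒳.toBispace 𝒴.toBispace}
    (h : proj z = proj w) : b' z / b z = b' w / b w := by
  obtain ⟨g, hg, rfl⟩ := proj_eq_iff.1 h
  rw [hb.apply_diag, hb'.apply_diag, mul_div_mul_left _ _ (𝒴.adjoining.pos _).ne']

theorem IsCompositeCochain.existsUnique_eq_mul (hb : IsCompositeCochain 𝒳 𝒴 b)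
    (hb' : IsCompositeCochain 𝒳 𝒴 b') :
    ∃! c : OrbitSpace 𝒳.toBispace 𝒴.toBispace → ℝ, ∀ z, b' z = c (proj z) * b z := by
  refine ⟨fun ω => b' ω.rep / b ω.rep, fun z => ?_, fun c hc => funext fun ω => ?_⟩
  · dsimp only
    rw [hb.div_eq_of_proj_eq hb' (proj_rep (proj z)), div_mul_cancel₀ _ (hb.pos z).ne']
  · rw [hc, proj_rep, mul_div_cancel_right₀ _ (hb.pos _).ne']

variable {c : OrbitSpace 𝒳.toBispace 𝒴.toBispace → ℝ}

theorem IsCompositeCochain.apply_proj_eq_div (hb : IsCompositeCochain 𝒳 𝒴 b)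
    (hc : ∀ z, b' z = c (proj z) * b z) (z : FibreProd 𝒳.toBispace 𝒴.toBispace) :
    c (proj z) = b' z / b z := by
  rw [hc, mul_div_cancel_right₀ _ (hb.pos z).ne']

theorem IsCompositeCochain.continuous_of_eq_mul (hb : IsCompositeCochain 𝒳 𝒴 b)
    (hb' : IsCompositeCochain 𝒳 𝒴 b') (hc : ∀ z, b' z = c (proj z) * b z) : Continuous c :=
  isQuotientMap_proj.continuous_iff.2 <|
    (hb'.continuous.div hb.continuous fun z => (hb.pos z).ne').congr fun z =>
      (hb.apply_proj_eq_div hc z).symm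

theorem IsCompositeCochain.pos_of_eq_mul (hb : IsCompositeCochain 𝒳 𝒴 b)
    (hb' : IsCompositeCochain 𝒳 𝒴 b') (hc : ∀ z, b' z = c (proj z) * b z)
    (ω : OrbitSpace 𝒳.toBispace 𝒴.toBispace) : 0 < c ω := by
  obtain ⟨z, rfl⟩ := proj_surjective ω
  rw [hb.apply_proj_eq_div hc]
  exact div_pos (hb'.pos z) (hb.pos z)

end Cochain

section FibreProdIntegral

variable [BorelSpace X] [T2Space X] [LocallyCompactSpace X] [T2Space Y] [T2Space U₂]

theorem exists_compactlySupported_integral_extendByZero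
    (F : C_c(FibreProd 𝒳.toBispace 𝒴.toBispace, ℝ)) :
    ∃ k : C_c(Y, ℝ), ∀ y, k y = ∫ x, extendByZero F x y ∂𝒳.lam (𝒴.left.mom y) := by
  have h_supp : ∀ x y, 𝒳.right.mom x = 𝒴.left.mom y → extendByZero F x y ≠ 0 →
      x ∈ fst '' tsupport F ∧ y ∈ snd '' tsupport F := fun x y h hFxy => by
    rw [extendByZero_eq F h] at hFxy
    exact ⟨⟨_, subset_tsupport _ hFxy, rfl⟩, ⟨_, subset_tsupport _ hFxy, rfl⟩⟩
  refine ⟨⟨⟨fun y => ∫ x, extendByZero F x y ∂𝒳.lam (𝒴.left.mom y), ?_⟩, ?_⟩, fun y => rfl⟩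
  · refine 𝒳.family.continuous_fibre_integral 𝒳.right_continuous.mom 𝒴.left_continuous.mom
      (F := fun y x => extendByZero F x y) ?_ fun y => ⟨Set.univ, Filter.univ_mem,
        fst '' tsupport F, F.hasCompactSupport.isCompact.image FibreProd.continuous_fst,
        fun y _ x h hFxy => (h_supp x y h hFxy).1⟩
    exact (continuousOn_extendByZero F.continuous).comp
      (by fun_prop : ContinuousOn (fun a : Y × X => (a.2, a.1)) _) fun a ha => ha
  · refine HasCompactSupport.of_support_subset_isCompact
      (F.hasCompactSupport.isCompact.image FibreProd.continuous_snd) fun y hy => ?_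
    contrapose! hy
    refine Function.notMem_support.2 (𝒳.family.integral_eq_zero fun x hx => ?_)
    by_contra hFxy
    exact hy (h_supp x y hx hFxy).2

theorem continuous_fibreProdIntegral (F : C_c(FibreProd 𝒳.toBispace 𝒴.toBispace, ℝ)) :
    Continuous fun u => fibreProdIntegral 𝒳 𝒴 u F := by
  obtain ⟨k, hk⟩ := exists_compactlySupported_integral_extendByZero F
  simp only [fibreProdIntegral_eq, ← hk]
  exact 𝒴.family.continuous_integral k

theorem fibreProdIntegral_eq_of_rightAct {c : G₃}
    {F F' : C_c(FibreProd 𝒳.toBispace 𝒴.toBispace, ℝ)}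
    (h : ∀ z (hz : 𝒴.right.mom z.snd = 𝓖₃.r c), F' z = F (z.rightAct c hz)) :
    fibreProdIntegral 𝒳 𝒴 (𝓖₃.r c) F' = fibreProdIntegral 𝒳 𝒴 (𝓖₃.s c) F := by
  obtain ⟨k, hk⟩ := exists_compactlySupported_integral_extendByZero F
  rw [fibreProdIntegral_eq, fibreProdIntegral_eq]
  simp only [← hk]
  rw [← 𝒴.invariant c k]
  refine 𝒴.family.integral_congr fun y hy => ?_
  rw [dif_pos hy, hk, 𝒴.left_mom_act]
  refine 𝒳.family.integral_congr fun x hx => ?_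
  rw [extendByZero_eq _ hx, extendByZero_eq _ (hx.trans (𝒴.left_mom_act _ _ _).symm)]
  exact h ⟨(x, y), hx⟩ hy

end FibreProdIntegral

namespace IsComposite

variable {b b' φ : FibreProd 𝒳.toBispace 𝒴.toBispace → ℝ}
  {μ μ' : U₃ → Measure (OrbitSpace 𝒳.toBispace 𝒴.toBispace)}

variable [T2Space X] [T2Space Y]

/-- The function `φ (f ∘ π) b`, whose integral against `α × β_u` is the integral of `f` against the
composite family. -/
def weightedLift (hμ : IsComposite 𝒳 𝒴 b μ)
    (hφ : IsCutoff 𝓖₂ (diagAction 𝒳.toBispace 𝒴.toBispace) proj φ)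
    (f : C_c(OrbitSpace 𝒳.toBispace 𝒴.toBispace, ℝ)) :
    C_c(FibreProd 𝒳.toBispace 𝒴.toBispace, ℝ) :=
  ⟨⟨fun z => hφ.lift isQuotientMap_proj.continuous f z * b z,
    (hφ.lift _ f).continuous.mul hμ.cochain.continuous⟩, (hφ.lift _ f).hasCompactSupport.mul_right⟩

theorem integral_eq (hμ : IsComposite 𝒳 𝒴 b μ)
    (hφ : IsCutoff 𝓖₂ (diagAction 𝒳.toBispace 𝒴.toBispace) proj φ)
    (hπ : (diagAction 𝒳.toBispace 𝒴.toBispace).IsOrbitMap proj)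
    (f : C_c(OrbitSpace 𝒳.toBispace 𝒴.toBispace, ℝ)) (u : U₃) :
    ∫ ω, f ω ∂μ u = fibreProdIntegral 𝒳 𝒴 u (hμ.weightedLift hφ f) := by
  refine Eq.trans ?_ (hμ.lift u (hφ.lift isQuotientMap_proj.continuous f))
  congr 1 with ω
  rw [orbitIntegral_eq]
  refine Eq.trans ?_ (hφ.integralOverOrbit_mul_comp hπ f _).symm
  rw [proj_rep]

theorem measure_compl_rightMom_preimage [T2Space U₃]
    [T2Space (OrbitSpace 𝒳.toBispace 𝒴.toBispace)]
    [LocallyCompactSpace (OrbitSpace 𝒳.toBispace 𝒴.toBispace)] (hμ : IsComposite 𝒳 𝒴 b μ)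
    (hφ : IsCutoff 𝓖₂ (diagAction 𝒳.toBispace 𝒴.toBispace) proj φ)
    (hπ : (diagAction 𝒳.toBispace 𝒴.toBispace).IsOrbitMap proj) (u : U₃) :
    μ u (rightMom ⁻¹' {u})ᶜ = 0 := by
  have := hμ.regular u
  have h_open : IsOpen (rightMom ⁻¹' {u} : Set (OrbitSpace 𝒳.toBispace 𝒴.toBispace))ᶜ :=
    (isClosed_singleton.preimage (continuous_rightMom 𝒴.right_continuous)).isOpen_compl
  rw [h_open.measure_eq_iSup_isCompact]
  simp only [ENNReal.iSup_eq_zero]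
  intro K hKV hK
  obtain ⟨f, hf_one, hf_mem, hfV⟩ := exists_compactlySupported_eq_one hK h_open hKV
  have h_integral : ∫ ω, f ω ∂μ u = 0 := by
    rw [hμ.integral_eq hφ hπ]
    refine 𝒴.family.integral_eq_zero fun y hy => 𝒳.family.integral_eq_zero fun x hx => ?_
    have hf_zero : f (proj ⟨(x, y), hx⟩) = 0 := by
      by_contra h
      exact hfV h hy
    refine (extendByZero_eq (hμ.weightedLift hφ f) hx).trans ?_
    change φ _ * f (proj ⟨(x, y), hx⟩) * b _ = 0
    rw [hf_zero, mul_zero, zero_mul]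
  have h_ae : ∀ᵐ ω ∂μ u, f ω = 0 :=
    (integral_eq_zero_iff_of_nonneg (fun ω => (hf_mem ω).1) f.integrable).1 h_integral
  refine measure_mono_null (fun ω hω => ?_) h_ae
  exact ((hf_one ω hω).trans_ne one_ne_zero : f ω ≠ 0)

theorem isRNDeriv [T2Space (OrbitSpace 𝒳.toBispace 𝒴.toBispace)]
    [LocallyCompactSpace (OrbitSpace 𝒳.toBispace 𝒴.toBispace)]
    (hμ : IsComposite 𝒳 𝒴 b μ) (hμ' : IsComposite 𝒳 𝒴 b' μ')
    (hφ : IsCutoff 𝓖₂ (diagAction 𝒳.toBispace 𝒴.toBispace) proj φ)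
    (hπ : (diagAction 𝒳.toBispace 𝒴.toBispace).IsOrbitMap proj)
    {c : OrbitSpace 𝒳.toBispace 𝒴.toBispace → ℝ} (hc : ∀ z, b' z = c (proj z) * b z) :
    IsRNDeriv μ' μ c := by
  intro u
  have := hμ.regular u
  have := hμ'.regular u
  have hc_cont := hμ.cochain.continuous_of_eq_mul hμ'.cochain hc
  refine eq_withDensity_of_integral_eq_integral_mul hc_cont
    (hμ.cochain.pos_of_eq_mul hμ'.cochain hc) fun f => ?_
  let fc : C_c(OrbitSpace 𝒳.toBispace 𝒴.toBispace, ℝ) :=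
    ⟨⟨fun ω => f ω * c ω, f.continuous.mul hc_cont⟩, f.hasCompactSupport.mul_right⟩
  refine (hμ'.integral_eq hφ hπ f u).trans (Eq.trans ?_ (hμ.integral_eq hφ hπ fc u).symm)
  congr 1 with z
  change φ z * f (proj z) * b' z = φ z * (f (proj z) * c (proj z)) * b z
  rw [hc z]
  ring

theorem equivalentFamilies [T2Space (OrbitSpace 𝒳.toBispace 𝒴.toBispace)]
    [LocallyCompactSpace (OrbitSpace 𝒳.toBispace 𝒴.toBispace)]
    (hμ : IsComposite 𝒳 𝒴 b μ) (hμ' : IsComposite 𝒳 𝒴 b' μ')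
    (hφ : IsCutoff 𝓖₂ (diagAction 𝒳.toBispace 𝒴.toBispace) proj φ)
    (hπ : (diagAction 𝒳.toBispace 𝒴.toBispace).IsOrbitMap proj) : EquivalentFamilies μ μ' := by
  obtain ⟨c, hc, -⟩ := hμ'.cochain.existsUnique_eq_mul hμ.cochain
  obtain ⟨c', hc', -⟩ := hμ.cochain.existsUnique_eq_mul hμ'.cochain
  have h_deriv := hμ'.isRNDeriv hμ hφ hπ hc
  have h_deriv' := hμ.isRNDeriv hμ' hφ hπ hc'
  refine ⟨fun u => ⟨?_, ?_⟩, c, hμ'.cochain.continuous_of_eq_mul hμ.cochain hc,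
    hμ'.cochain.pos_of_eq_mul hμ.cochain hc, h_deriv⟩
  · rw [h_deriv u]
    exact withDensity_absolutelyContinuous _ _
  · rw [h_deriv' u]
    exact withDensity_absolutelyContinuous _ _

theorem isContinuousFamily [BorelSpace X] [LocallyCompactSpace X] [T2Space U₂] [T2Space U₃]
    [T2Space (OrbitSpace 𝒳.toBispace 𝒴.toBispace)]
    [LocallyCompactSpace (OrbitSpace 𝒳.toBispace 𝒴.toBispace)] (hμ : IsComposite 𝒳 𝒴 b μ)
    (hφ : IsCutoff 𝓖₂ (diagAction 𝒳.toBispace 𝒴.toBispace) proj φ)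
    (hπ : (diagAction 𝒳.toBispace 𝒴.toBispace).IsOrbitMap proj) :
    IsContinuousFamily rightMom μ where
  regular := hμ.regular
  concentrated := hμ.measure_compl_rightMom_preimage hφ hπ
  continuous_integral f := by
    simp only [hμ.integral_eq hφ hπ f]
    exact continuous_fibreProdIntegral _

end IsComposite

theorem apply_rightActAux_eq_orbitIntegral {φ : FibreProd 𝒳.toBispace 𝒴.toBispace → ℝ}
    (hφ : IsCutoff 𝓖₂ (diagAction 𝒳.toBispace 𝒴.toBispace) proj φ)
    (hπ : (diagAction 𝒳.toBispace 𝒴.toBispace).IsOrbitMap proj)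
    (f : OrbitSpace 𝒳.toBispace 𝒴.toBispace → ℝ) {c : G₃}
    {F : FibreProd 𝒳.toBispace 𝒴.toBispace → ℝ}
    (hF : ∀ z (hz : 𝒴.right.mom z.snd = 𝓖₃.r c),
      F z = φ (z.rightAct c hz) * f (proj (z.rightAct c hz)))
    {ω : OrbitSpace 𝒳.toBispace 𝒴.toBispace} (hω : rightMom ω = 𝓖₃.r c) :
    f (rightActAux ω c) = orbitIntegral 𝒳 𝒴 F ω := by
  have hω_rep : 𝒴.right.mom ω.rep.snd = 𝓖₃.r c := by
    rw [← proj_rep ω] at hω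
    exact hω
  have h_int := hφ.integralOverOrbit_mul_comp hπ f (ω.rep.rightAct c hω_rep)
  rw [← rightActAux_proj _ c hω_rep, proj_rep] at h_int
  rw [← h_int, orbitIntegral_eq]
  refine 𝓖₂.haar_family.integral_congr fun g hg => ?_
  have hg' : ω.rep.mom = 𝓖₂.r g := hg.symm
  have hg_mom : 𝒴.right.mom (ω.rep.diag g hg').snd = 𝓖₃.r c :=
    (𝒴.right_mom_act _ _ _).trans hω_rep
  rw [(diagAction 𝒳.toBispace 𝒴.toBispace).totalAct_eq hg',
    (diagAction 𝒳.toBispace 𝒴.toBispace).totalAct_eq (x := ω.rep.rightAct c hω_rep) hg']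
  refine Eq.trans ?_ (hF (ω.rep.diag g hg') hg_mom).symm
  change φ ((ω.rep.rightAct c hω_rep).diag g hg') *
    f (proj ((ω.rep.rightAct c hω_rep).diag g hg')) = _
  rw [diag_rightAct ω.rep g c hg' hω_rep]

theorem IsComposite.isInvariantFamily [BorelSpace X] [T2Space X] [LocallyCompactSpace X]
    [T2Space Y] [T2Space U₂] [T2Space U₃] [T2Space (OrbitSpace 𝒳.toBispace 𝒴.toBispace)]
    [LocallyCompactSpace (OrbitSpace 𝒳.toBispace 𝒴.toBispace)]
    [LocallyCompactSpace (FibreProd 𝒳.toBispace 𝒴.toBispace)]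
    {b φ : FibreProd 𝒳.toBispace 𝒴.toBispace → ℝ}
    {μ : U₃ → Measure (OrbitSpace 𝒳.toBispace 𝒴.toBispace)} (hμ : IsComposite 𝒳 𝒴 b μ)
    (hφ : IsCutoff 𝓖₂ (diagAction 𝒳.toBispace 𝒴.toBispace) proj φ)
    (hπ : (diagAction 𝒳.toBispace 𝒴.toBispace).IsOrbitMap proj) :
    (bispace 𝒳.toBispace 𝒴.toBispace).right.IsInvariantFamily μ := by
  intro c f
  obtain ⟨F', hF'⟩ :=
    (rightAction_isContinuous (A := 𝒳.toBispace) (B := 𝒴.toBispace)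
      𝒴.right_continuous).exists_compactlySupported_comp_act c
        (hφ.lift isQuotientMap_proj.continuous f)
  let F'b : C_c(FibreProd 𝒳.toBispace 𝒴.toBispace, ℝ) :=
    ⟨⟨fun z => F' z * b z, F'.continuous.mul hμ.cochain.continuous⟩, F'.hasCompactSupport.mul_right⟩
  have hF'b : ∀ z (hz : 𝒴.right.mom z.snd = 𝓖₃.r c),
      F'b z = hμ.weightedLift hφ f (z.rightAct c hz) := fun z hz =>
    congrArg₂ (· * ·) (hF' z hz) (hμ.cochain.invariant z c hz).symm
  rw [hμ.integral_eq hφ hπ, ← fibreProdIntegral_eq_of_rightAct hF'b]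
  refine Eq.trans ?_ (hμ.lift (𝓖₃.r c) F')
  refine (hμ.isContinuousFamily hφ hπ).integral_congr fun ω hω => ?_
  exact (dif_pos hω).trans (apply_rightActAux_eq_orbitIntegral hφ hπ f hF' hω)

end CompositeMeasures


namespace LeftAction

variable {G U X : Type*} [TopologicalSpace G] [TopologicalSpace U]

open Classical in
/-- The extension by zero of a function on the transformation groupoid `𝓖 ⋉ X` to `G × X`, in
curried form. -/
def extendByZero {𝓖 : TopGroupoid G U} (L : LeftAction 𝓖 X) (Δ : L.Trans → ℝ) (g : G) (x : X) :
    ℝ :=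
  if h : 𝓖.s g = L.mom x then Δ ⟨(g, x), h⟩ else 0

theorem extendByZero_eq {𝓖 : TopGroupoid G U} (L : LeftAction 𝓖 X) (Δ : L.Trans → ℝ) {g : G}
    {x : X} (h : 𝓖.s g = L.mom x) : L.extendByZero Δ g x = Δ ⟨(g, x), h⟩ := dif_pos h

variable [TopologicalSpace X]

theorem continuousOn_extendByZero {𝓖 : TopGroupoid G U} (L : LeftAction 𝓖 X) {Δ : L.Trans → ℝ}
    (hΔ : Continuous Δ) :
    ContinuousOn (fun a : G × X => L.extendByZero Δ a.1 a.2) {a | 𝓖.s a.1 = L.mom a.2} := by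
  rw [continuousOn_iff_continuous_domRestrict]
  exact hΔ.congr fun a => (L.extendByZero_eq Δ a.2).symm

namespace IsContinuous

theorem continuousOn_totalAct_inv {𝓖 : TopGroupoid G U} {L : LeftAction 𝓖 X}
    (hL : L.IsContinuous) :
    ContinuousOn (fun a : X × G => L.totalAct (𝓖.inv a.2) a.1) {a | 𝓖.r a.2 = L.mom a.1} :=
  hL.continuousOn_totalAct.comp
    ((𝓖.continuous_inv.comp continuous_snd).prodMk continuous_fst).continuousOn
    fun a ha => (𝓖.s_inv a.2).trans ha

theorem continuousOn_comp_totalAct_inv {𝓖 : TopGroupoid G U} {L : LeftAction 𝓖 X}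
    (hL : L.IsContinuous) {E : G → X → ℝ}
    (hE : ContinuousOn (fun a : G × X => E a.1 a.2) {a | 𝓖.s a.1 = L.mom a.2}) :
    ContinuousOn (fun a : X × G => E a.2 (L.totalAct (𝓖.inv a.2) a.1))
      {a | 𝓖.r a.2 = L.mom a.1} :=
  hE.comp (continuous_snd.continuousOn.prodMk hL.continuousOn_totalAct_inv)
    fun _ ha => (L.mom_totalAct_inv ha).symm

theorem isClosed_setOf_s_eq_mom [T2Space U] {𝓖 : TopGroupoid G U} {L : LeftAction 𝓖 X}
    (hL : L.IsContinuous) : IsClosed {a : G × X | 𝓖.s a.1 = L.mom a.2} :=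
  isClosed_eq (𝓖.continuous_s.comp continuous_fst) (hL.mom.comp continuous_snd)

variable [T2Space U] [T2Space G] [LocallyCompactSpace G] [MeasurableSpace G] [T2Space X]
  {𝓖 : HaarGroupoid G U} {L : LeftAction 𝓖.toTopGroupoid X}

theorem exists_compactlySupported_integral_totalAct_inv [BorelSpace G] (hL : L.IsContinuous)
    {E : G → X → ℝ} (hE : ContinuousOn (fun a : G × X => E a.1 a.2) {a | 𝓖.s a.1 = L.mom a.2})
    {K : Set G} {C : Set X} (hK : IsCompact K) (hC : IsCompact C)
    (hEKC : ∀ g x, E g x ≠ 0 → g ∈ K ∧ x ∈ C) :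
    ∃ f : C_c(X, ℝ), ∀ x, f x = ∫ g, E g (L.totalAct (𝓖.inv g) x) ∂𝓖.haar (L.mom x) := by
  obtain ⟨M, hM, hM_mem⟩ := hL.exists_isCompact_forall_mem hK hC
  refine ⟨⟨⟨fun x => ∫ g, E g (L.totalAct (𝓖.inv g) x) ∂𝓖.haar (L.mom x), ?_⟩, ?_⟩,
    fun _ => rfl⟩
  · exact 𝓖.haar_family.continuous_fibre_integral 𝓖.continuous_r hL.mom
      (hL.continuousOn_comp_totalAct_inv hE) fun x₀ => ⟨Set.univ, Filter.univ_mem, K, hK,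
        fun x _ g _ hEgx => (hEKC _ _ hEgx).1⟩
  · refine HasCompactSupport.of_support_subset_isCompact hM fun x hx => ?_
    contrapose! hx
    refine Function.notMem_support.2 (𝓖.haar_family.integral_eq_zero fun g hg => ?_)
    by_contra hEgx
    obtain ⟨hgK, hxC⟩ := hEKC _ _ hEgx
    exact hx (hM_mem g x hg hgK hxC)

theorem exists_compactlySupported_integral_inv [BorelSpace G] (hL : L.IsContinuous)
    (F : C_c(G × X, ℝ)) :
    ∃ f : C_c(X, ℝ), ∀ x, f x = ∫ g, F (𝓖.inv g, x) ∂𝓖.haar (L.mom x) := by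
  have hK := (F.hasCompactSupport.isCompact.image continuous_fst).image 𝓖.continuous_inv
  have hC := F.hasCompactSupport.isCompact.image continuous_snd
  refine ⟨⟨⟨fun x => ∫ g, F (𝓖.inv g, x) ∂𝓖.haar (L.mom x), ?_⟩, ?_⟩, fun _ => rfl⟩
  · refine 𝓖.haar_family.continuous_fibre_integral 𝓖.continuous_r hL.mom
      (F := fun x g => F (𝓖.inv g, x)) ?_
      fun x => ⟨Set.univ, Filter.univ_mem, _, hK, fun x _ g _ hFgx => ?_⟩
    · exact (F.continuous.comp
        ((𝓖.continuous_inv.comp continuous_snd).prodMk continuous_fst)).continuousOn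
    · exact ⟨_, ⟨_, subset_tsupport _ hFgx, rfl⟩, 𝓖.inv_inv g⟩
  · refine HasCompactSupport.of_support_subset_isCompact hC fun x hx => ?_
    contrapose! hx
    refine Function.notMem_support.2 (𝓖.haar_family.integral_eq_zero fun g _ => ?_)
    by_contra hFgx
    exact hx ⟨_, subset_tsupport _ hFgx, rfl⟩

end IsContinuous

end LeftAction

namespace IsAdjoining

variable {G U V X : Type*} [TopologicalSpace G] [T2Space G] [LocallyCompactSpace G]
  [MeasurableSpace G] [TopologicalSpace U] [T2Space U] [TopologicalSpace X] [T2Space X]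
  [LocallyCompactSpace X] [MeasurableSpace X] {𝓖 : HaarGroupoid G U}
  {L : LeftAction 𝓖.toTopGroupoid X} {lam : V → Measure X}

theorem of_integral_eq (hL : L.IsContinuous) {D : G → X → ℝ}
    (hD : ContinuousOn (fun a : G × X => D a.1 a.2) {a | 𝓖.s a.1 = L.mom a.2})
    (hD_pos : ∀ g x, 𝓖.s g = L.mom x → 0 < D g x)
    (h_int : ∀ (v : V) (F : C_c(G × X, ℝ)),
      ∫ x, ∫ g, F (𝓖.inv g, x) ∂𝓖.haar (L.mom x) ∂lam v =
        ∫ x, ∫ g, F (g, L.totalAct (𝓖.inv g) x) * D g (L.totalAct (𝓖.inv g) x)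
          ∂𝓖.haar (L.mom x) ∂lam v) :
    IsAdjoining 𝓖 L lam fun p => D p.1.1 p.1.2 where
  continuous := hD.domRestrict
  pos p := hD_pos _ _ p.2
  integral_eq v F₀ := by
    have hcompact : IsCompact (Subtype.val '' tsupport F₀ : Set (G × X)) :=
      F₀.hasCompactSupport.isCompact.image continuous_subtype_val
    obtain ⟨F, hF⟩ := exists_compactlySupported_eqOn hL.isClosed_setOf_s_eq_mom hcompact
      (L.continuousOn_extendByZero F₀.continuous) fun a ha hFa => by
        rw [L.extendByZero_eq _ ha] at hFa
        exact ⟨_, subset_tsupport _ hFa, rfl⟩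
    have hF_eq : ∀ p : L.Trans, F₀ p = F p.1 := fun p =>
      ((hF p.2).trans (L.extendByZero_eq F₀ p.2)).symm
    refine Eq.trans ?_ ((h_int v F).trans ?_)
    · congr 1 with x
      refine 𝓖.haar_family.integral_congr fun g hg => ?_
      rw [dif_pos hg, hF_eq]
      rfl
    · congr 1 with x
      refine 𝓖.haar_family.integral_congr fun g hg => ?_
      rw [dif_pos hg, hF_eq, L.totalAct_eq ((𝓖.s_inv g).trans hg)]
      rfl

variable [TopologicalSpace V] [T2Space V] {p : X → V} {Δ : L.Trans → ℝ}

theorem integral_inv_eq (hΔ : IsAdjoining 𝓖 L lam Δ) (hL : L.IsContinuous)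
    (hlam : IsContinuousFamily p lam) (hp : Continuous p)
    (hp_act : ∀ g x h, p (L.act g x h) = p x) {v : V} {E : G → X → ℝ}
    (hE : ContinuousOn (fun a : G × X => E a.1 a.2) {a | 𝓖.s a.1 = L.mom a.2 ∧ p a.2 = v})
    {K : Set G} {C : Set X} (hK : IsCompact K) (hC : IsCompact C)
    (hEKC : ∀ g x, p x = v → E g x ≠ 0 → g ∈ K ∧ x ∈ C) :
    ∫ x, ∫ g, E (𝓖.inv g) x ∂𝓖.haar (L.mom x) ∂lam v =
      ∫ x, ∫ g, E g (L.totalAct (𝓖.inv g) x) * L.extendByZero Δ g (L.totalAct (𝓖.inv g) x)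
        ∂𝓖.haar (L.mom x) ∂lam v := by
  have hclosed : IsClosed {a : G × X | 𝓖.s a.1 = L.mom a.2 ∧ p a.2 = v} :=
    hL.isClosed_setOf_s_eq_mom.inter (isClosed_eq (hp.comp continuous_snd) continuous_const)
  obtain ⟨F, hF⟩ := exists_compactlySupported_eqOn hclosed (hK.prod hC) hE
    fun a ha hEa => hEKC _ _ ha.2 hEa
  let F₀ : C_c(L.Trans, ℝ) := ⟨⟨fun p => F p.1, F.continuous.comp continuous_subtype_val⟩,
    F.hasCompactSupport.comp_isClosedEmbedding
      hL.isClosed_setOf_s_eq_mom.isClosedEmbedding_subtypeVal⟩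
  refine Eq.trans ?_ ((hΔ.integral_eq v F₀).trans ?_)
  · refine hlam.integral_congr fun x hx => 𝓖.haar_family.integral_congr fun g hg => ?_
    rw [dif_pos hg]
    exact (@hF (𝓖.inv g, x) ⟨(𝓖.s_inv g).trans hg, hx⟩).symm
  · refine hlam.integral_congr fun x hx => 𝓖.haar_family.integral_congr fun g hg => ?_
    have hg_inv : 𝓖.s (𝓖.inv g) = L.mom x := (𝓖.s_inv g).trans hg
    have hgx : 𝓖.s g = L.mom (L.act (𝓖.inv g) x hg_inv) := (L.movePt g x hg).2
    rw [dif_pos hg, L.totalAct_eq hg_inv, L.extendByZero_eq Δ hgx]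
    exact congrArg (· * _) (@hF (g, L.act (𝓖.inv g) x hg_inv) ⟨hgx, (hp_act _ _ _).trans hx⟩)

end IsAdjoining


namespace IsCutoff

variable {H V Z Ω T : Type*} [TopologicalSpace H] [TopologicalSpace V] [MeasurableSpace H]
  [TopologicalSpace Z] [TopologicalSpace Ω] {𝓗 : HaarGroupoid H V}
  {R : RightAction 𝓗.toTopGroupoid Z} {π : Z → Ω} {φ : Z → ℝ}

theorem exists_isCompact_forall_mem [TopologicalSpace T] (hφ : IsCutoff 𝓗 R π φ)
    (F : C_c(T × Ω, ℝ)) :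
    ∃ (K : Set T) (C : Set Z), IsCompact K ∧ IsCompact C ∧
      ∀ t z, F (t, π z) * φ z ≠ 0 → t ∈ K ∧ z ∈ C := by
  obtain ⟨C, hC, hφC⟩ := hφ.hasFibrewiseCompactSupport _
    (F.hasCompactSupport.isCompact.image continuous_snd)
  refine ⟨_, C, F.hasCompactSupport.isCompact.image continuous_fst, hC, fun t z h => ?_⟩
  have hmem := subset_tsupport _ (left_ne_zero_of_mul h)
  exact ⟨⟨_, hmem, rfl⟩, hφC z ⟨_, hmem, rfl⟩ (right_ne_zero_of_mul h)⟩

theorem exists_apply_totalAct_ne_zero (hφ : IsCutoff 𝓗 R π φ) (z : Z) :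
    ∃ g, 𝓗.r g = R.mom z ∧ φ (R.totalAct z g) ≠ 0 := by
  by_contra! h
  exact one_ne_zero ((hφ.integralOverOrbit_eq_one z).symm.trans (𝓗.haar_family.integral_eq_zero h))

section Weighted

variable [TopologicalSpace T] {S : Set (T × Z)} {w : T → Z → ℝ}

theorem continuousOn_mul_totalAct (hφ : IsCutoff 𝓗 R π φ) (hR : R.IsContinuous)
    (hS : ∀ t z g, (t, z) ∈ S → (t, R.totalAct z g) ∈ S)
    (hw : ContinuousOn (fun a : T × Z => w a.1 a.2) S) :
    ContinuousOn (fun a : (T × Z) × H =>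
        w a.1.1 (R.totalAct a.1.2 a.2) * φ (R.totalAct a.1.2 a.2))
      {a | a.1 ∈ S ∧ 𝓗.r a.2 = R.mom a.1.2} := by
  have hact : ContinuousOn (fun a : (T × Z) × H => R.totalAct a.1.2 a.2)
      {a | a.1 ∈ S ∧ 𝓗.r a.2 = R.mom a.1.2} :=
    hR.continuousOn_totalAct.comp
      (by fun_prop : ContinuousOn (fun a : (T × Z) × H => (a.1.2, a.2)) _) fun a ha => ha.2.symm
  refine ContinuousOn.mul ?_ (hφ.continuous.comp_continuousOn hact)
  exact hw.comp
    ((by fun_prop : ContinuousOn (fun a : (T × Z) × H => a.1.1) _).prodMk hact)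
    fun a ha => hS _ _ _ ha.1

theorem continuousOn_mul_totalAct_right (hφ : IsCutoff 𝓗 R π φ) (hR : R.IsContinuous)
    (hS : ∀ t z g, (t, z) ∈ S → (t, R.totalAct z g) ∈ S)
    (hw : ContinuousOn (fun a : T × Z => w a.1 a.2) S) {t : T} {z : Z} (htz : (t, z) ∈ S) :
    ContinuousOn (fun g => w t (R.totalAct z g) * φ (R.totalAct z g)) (𝓗.r ⁻¹' {R.mom z}) :=
  (hφ.continuousOn_mul_totalAct hR hS hw).comp
    (by fun_prop : ContinuousOn (fun g => ((t, z), g)) _) fun _ hg => ⟨htz, hg⟩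

variable [T2Space H] [LocallyCompactSpace H]

theorem integralOverOrbit_mul_eq (hφ : IsCutoff 𝓗 R π φ) (hR : R.IsContinuous) (hP : R.IsProper)
    (hπ : R.IsOrbitMap π) (hS : ∀ t z g, (t, z) ∈ S → (t, R.totalAct z g) ∈ S)
    (hw : ContinuousOn (fun a : T × Z => w a.1 a.2) S) {t : T} {z z' : Z} (htz : (t, z) ∈ S)
    (hz : π z = π z') :
    integralOverOrbit 𝓗 R (fun y => w t y * φ y) z =
      integralOverOrbit 𝓗 R (fun y => w t y * φ y) z' := by
  obtain ⟨K, hK, hK_mem⟩ := hπ.exists_isCompact_arrows hP hφ.hasFibrewiseCompactSupport z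
  exact integralOverOrbit_eq_of_continuousOn hπ (hφ.continuousOn_mul_totalAct_right hR hS hw htz)
    hK (fun g hg h => hK_mem g hg (right_ne_zero_of_mul h)) hz

variable [BorelSpace H]

theorem continuousOn_integralOverOrbit_mul [WeaklyLocallyCompactSpace Z] (hφ : IsCutoff 𝓗 R π φ)
    (hR : R.IsContinuous) (hP : R.IsProper) (hπ : R.IsOrbitMap π)
    (hS : ∀ t z g, (t, z) ∈ S → (t, R.totalAct z g) ∈ S)
    (hw : ContinuousOn (fun a : T × Z => w a.1 a.2) S) :
    ContinuousOn (fun a : T × Z => integralOverOrbit 𝓗 R (fun z => w a.1 z * φ z) a.2) S := by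
  have := 𝓗.t2Space_units
  have hsnd : Continuous fun a : S => a.1.2 := by fun_prop
  rw [continuousOn_iff_continuous_domRestrict]
  refine 𝓗.haar_family.continuous_fibre_integral 𝓗.continuous_r (hR.mom.comp hsnd)
    (F := fun (a : S) g => w a.1.1 (R.totalAct a.1.2 g) * φ (R.totalAct a.1.2 g)) ?_ fun a₀ => ?_
  · exact (hφ.continuousOn_mul_totalAct hR hS hw).comp
      (by fun_prop : ContinuousOn (fun a : S × H => (a.1.1, a.2)) _) fun a ha => ⟨a.1.2, ha⟩
  · obtain ⟨N, hN, K, hK, hK_mem⟩ :=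
      hπ.exists_nhds_isCompact_arrows hP hφ.hasFibrewiseCompactSupport hsnd a₀
    exact ⟨N, hN, K, hK, fun a ha g hg h => hK_mem a ha g hg (right_ne_zero_of_mul h)⟩

theorem integralOverOrbit_mul_pos (hφ : IsCutoff 𝓗 R π φ) (hR : R.IsContinuous) (hP : R.IsProper)
    (hπ : R.IsOrbitMap π) (hS : ∀ t z g, (t, z) ∈ S → (t, R.totalAct z g) ∈ S)
    (hw : ContinuousOn (fun a : T × Z => w a.1 a.2) S)
    (hw_pos : ∀ t z, (t, z) ∈ S → 0 < w t z) {t : T} {z : Z} (htz : (t, z) ∈ S) :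
    0 < integralOverOrbit 𝓗 R (fun y => w t y * φ y) z := by
  have := 𝓗.t2Space_units
  have hw_orbit : ∀ g, 0 < w t (R.totalAct z g) := fun g => hw_pos _ _ (hS t z g htz)
  obtain ⟨K, hK, hK_mem⟩ := hπ.exists_isCompact_arrows hP hφ.hasFibrewiseCompactSupport z
  obtain ⟨g, hg, hφg⟩ := hφ.exists_apply_totalAct_ne_zero z
  exact integralOverOrbit_pos (hφ.continuousOn_mul_totalAct_right hR hS hw htz) hK
    (fun g hg h => hK_mem g hg (right_ne_zero_of_mul h))
    (fun g _ => mul_nonneg (hw_orbit g).le (hφ.nonneg _))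
    ⟨g, hg, mul_ne_zero (hw_orbit g).ne' hφg⟩

end Weighted

end IsCutoff

namespace FibreProd

variable {G₁ U₁ G₂ U₂ G₃ U₃ X Y : Type*}
  [TopologicalSpace G₁] [TopologicalSpace U₁] [TopologicalSpace G₂] [TopologicalSpace U₂]
  [TopologicalSpace G₃] [TopologicalSpace U₃]
  {𝓖₁ : TopGroupoid G₁ U₁} {𝓖₂ : TopGroupoid G₂ U₂} {𝓖₃ : TopGroupoid G₃ U₃}
  {A : Bispace 𝓖₁ 𝓖₂ X} {B : Bispace 𝓖₂ 𝓖₃ Y}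

theorem extendByZero_fst_snd (F : FibreProd A B → ℝ) (z : FibreProd A B) :
    extendByZero F z.fst z.snd = F z := extendByZero_eq F z.2

theorem continuousOn_extendByZero_left {T : Type*} [TopologicalSpace T] [TopologicalSpace X]
    [TopologicalSpace Y] {f : T → FibreProd A B → ℝ}
    (hf : Continuous fun a : T × FibreProd A B => f a.1 a.2) (y : Y) :
    ContinuousOn (fun a : T × X => extendByZero (f a.1) a.2 y)
      {a | A.right.mom a.2 = B.left.mom y} := by
  rw [continuousOn_iff_continuous_domRestrict]
  have hmk : Continuous fun a : {a : T × X | A.right.mom a.2 = B.left.mom y} =>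
      (a.1.1, (⟨(a.1.2, y), a.2⟩ : FibreProd A B)) :=
    Continuous.prodMk (by fun_prop) (Continuous.subtype_mk (by fun_prop) _)
  exact (hf.comp hmk).congr fun a => (extendByZero_eq (f a.1.1) a.2).symm

theorem fst_leftAction_totalAct (g : G₁) (z : FibreProd A B) :
    ((leftAction A B).totalAct g z).fst = A.left.totalAct g z.fst := by
  by_cases h : 𝓖₁.s g = A.left.mom z.fst
  · rw [(leftAction A B).totalAct_eq h, A.left.totalAct_eq h]
    rfl
  · rw [LeftAction.totalAct, LeftAction.totalAct, dif_neg h]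
    exact (dif_neg h) ▸ rfl

theorem snd_leftAction_totalAct (g : G₁) (z : FibreProd A B) :
    ((leftAction A B).totalAct g z).snd = z.snd := by
  by_cases h : 𝓖₁.s g = A.left.mom z.fst
  · rw [(leftAction A B).totalAct_eq h]
    rfl
  · exact congrArg snd (dif_neg h)

theorem leftAction_mom_diagAction_totalAct (z : FibreProd A B) (g : G₂) :
    (leftAction A B).mom ((diagAction A B).totalAct z g) = (leftAction A B).mom z := by
  by_cases h : z.mom = 𝓖₂.r g
  · rw [(diagAction A B).totalAct_eq h]
    exact A.left_mom_act _ _ _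
  · exact congrArg _ (dif_neg h)

theorem diagAction_mom_leftAction_totalAct (g : G₁) (z : FibreProd A B) :
    (diagAction A B).mom ((leftAction A B).totalAct g z) = (diagAction A B).mom z := by
  by_cases h : 𝓖₁.s g = A.left.mom z.fst
  · rw [(leftAction A B).totalAct_eq h]
    exact A.right_mom_act _ _ _
  · exact congrArg _ (dif_neg h)

theorem leftAction_totalAct_diagAction_totalAct {g : G₁} {z : FibreProd A B} {γ : G₂}
    (hg : 𝓖₁.s g = (leftAction A B).mom z) (hγ : (diagAction A B).mom z = 𝓖₂.r γ) :
    (leftAction A B).totalAct g ((diagAction A B).totalAct z γ) =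
      (diagAction A B).totalAct ((leftAction A B).totalAct g z) γ := by
  have hg' : 𝓖₁.s g = (leftAction A B).mom (z.diag γ hγ) := hg.trans (A.left_mom_act _ _ hγ).symm
  have hγ' : (diagAction A B).mom (z.leftAct g hg) = 𝓖₂.r γ := (A.right_mom_act _ _ hg).trans hγ
  rw [(diagAction A B).totalAct_eq hγ, (leftAction A B).totalAct_eq hg]
  refine ((leftAction A B).totalAct_eq hg').trans (Eq.trans ?_
    ((diagAction A B).totalAct_eq hγ').symm)
  exact (diag_leftAct g z γ hg hγ).symm

end FibreProd

section CompositeAdjoining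

open FibreProd OrbitSpace

variable {G₁ U₁ G₂ U₂ G₃ U₃ X Y : Type*}
  [TopologicalSpace G₁] [TopologicalSpace U₁] [TopologicalSpace G₂] [TopologicalSpace U₂]
  [TopologicalSpace G₃] [TopologicalSpace U₃] [TopologicalSpace X] [TopologicalSpace Y]
  [MeasurableSpace G₁] [MeasurableSpace G₂] [MeasurableSpace G₃]
  [MeasurableSpace X] [MeasurableSpace Y]
  {𝓖₁ : HaarGroupoid G₁ U₁} {𝓖₂ : HaarGroupoid G₂ U₂} {𝓖₃ : HaarGroupoid G₃ U₃}
  {𝒳 : TopologicalCorrespondence 𝓖₁ 𝓖₂ X} {𝒴 : TopologicalCorrespondence 𝓖₂ 𝓖₃ Y}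

/-- The function `Δ₁(g, x) b(x, y) / b(gx, y)` on `G₁ ⋉ (X ×_{U₂} Y)`, which makes `b (α × β_u)`
quasi-invariant under `G₁`; it is extended by zero. -/
def compositeWeight (b : FibreProd 𝒳.toBispace 𝒴.toBispace → ℝ) (g : G₁)
    (z : FibreProd 𝒳.toBispace 𝒴.toBispace) : ℝ :=
  𝒳.left.extendByZero 𝒳.adj g z.fst *
    (b z / b ((leftAction 𝒳.toBispace 𝒴.toBispace).totalAct g z))

/-- The adjoining function of a composite. The weight `Δ₁(g, x) b(x, y) / b(gx, y)` need not be
constant on the orbits of the diagonal action, since `Δ₁` is only determined on the supports of the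
measures, so it is averaged over each orbit by means of a cutoff function `φ`. -/
def compositeAdj (b φ : FibreProd 𝒳.toBispace 𝒴.toBispace → ℝ) (g : G₁)
    (ω : OrbitSpace 𝒳.toBispace 𝒴.toBispace) : ℝ :=
  integralOverOrbit 𝓖₂ (diagAction 𝒳.toBispace 𝒴.toBispace)
    (fun z => compositeWeight b g z * φ z) ω.rep

variable {b φ : FibreProd 𝒳.toBispace 𝒴.toBispace → ℝ}

theorem continuousOn_compositeWeight (hb : IsCompositeCochain 𝒳 𝒴 b) :
    ContinuousOn (fun a : G₁ × FibreProd 𝒳.toBispace 𝒴.toBispace => compositeWeight b a.1 a.2)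
      {a | 𝓖₁.s a.1 = (leftAction 𝒳.toBispace 𝒴.toBispace).mom a.2} := by
  refine ContinuousOn.mul ?_ (ContinuousOn.div ?_ ?_ fun a _ => (hb.pos _).ne')
  · exact (𝒳.left.continuousOn_extendByZero 𝒳.adjoining.continuous).comp
      (continuous_fst.prodMk (FibreProd.continuous_fst.comp continuous_snd)).continuousOn
      fun a ha => ha
  · exact (hb.continuous.comp continuous_snd).continuousOn
  · exact hb.continuous.comp_continuousOn
      (leftAction_isContinuous 𝒳.left_continuous).continuousOn_totalAct

theorem compositeWeight_pos (hb : IsCompositeCochain 𝒳 𝒴 b) {g : G₁}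
    {z : FibreProd 𝒳.toBispace 𝒴.toBispace}
    (h : 𝓖₁.s g = (leftAction 𝒳.toBispace 𝒴.toBispace).mom z) : 0 < compositeWeight b g z := by
  rw [compositeWeight, 𝒳.left.extendByZero_eq 𝒳.adj h]
  exact mul_pos (𝒳.adjoining.pos _) (div_pos (hb.pos _) (hb.pos _))

variable [T2Space G₂] [LocallyCompactSpace G₂]

theorem compositeAdj_proj (hb : IsCompositeCochain 𝒳 𝒴 b)
    (hφ : IsCutoff 𝓖₂ (diagAction 𝒳.toBispace 𝒴.toBispace) proj φ)
    (hP : (diagAction 𝒳.toBispace 𝒴.toBispace).IsProper)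
    (hπ : (diagAction 𝒳.toBispace 𝒴.toBispace).IsOrbitMap proj) {g : G₁}
    {z : FibreProd 𝒳.toBispace 𝒴.toBispace}
    (h : 𝓖₁.s g = (leftAction 𝒳.toBispace 𝒴.toBispace).mom z) :
    compositeAdj b φ g (proj z) = integralOverOrbit 𝓖₂ (diagAction 𝒳.toBispace 𝒴.toBispace)
      (fun z => compositeWeight b g z * φ z) z :=
  (hφ.integralOverOrbit_mul_eq (diagAction_isContinuous 𝒳.right_continuous 𝒴.left_continuous) hP hπ
    (fun _ z γ h => h.trans (leftAction_mom_diagAction_totalAct z γ).symm)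
    (continuousOn_compositeWeight hb) h (proj_rep _).symm).symm

variable [BorelSpace G₂]

theorem continuousOn_compositeAdj [LocallyCompactSpace (FibreProd 𝒳.toBispace 𝒴.toBispace)]
    (hb : IsCompositeCochain 𝒳 𝒴 b)
    (hφ : IsCutoff 𝓖₂ (diagAction 𝒳.toBispace 𝒴.toBispace) proj φ)
    (hP : (diagAction 𝒳.toBispace 𝒴.toBispace).IsProper)
    (hπ : (diagAction 𝒳.toBispace 𝒴.toBispace).IsOrbitMap proj) :
    ContinuousOn (fun a : G₁ × OrbitSpace 𝒳.toBispace 𝒴.toBispace => compositeAdj b φ a.1 a.2)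
      {a | 𝓖₁.s a.1 = leftMom a.2} := by
  refine continuousOn_of_isOpenQuotientMap_comp
    (IsOpenQuotientMap.prodMap .id hπ.isOpenQuotientMap) ?_
  exact (hφ.continuousOn_integralOverOrbit_mul
    (diagAction_isContinuous 𝒳.right_continuous 𝒴.left_continuous) hP hπ
    (fun _ z γ h => h.trans (leftAction_mom_diagAction_totalAct z γ).symm)
    (continuousOn_compositeWeight hb)).congr fun a ha => compositeAdj_proj hb hφ hP hπ ha

theorem compositeAdj_pos (hb : IsCompositeCochain 𝒳 𝒴 b)
    (hφ : IsCutoff 𝓖₂ (diagAction 𝒳.toBispace 𝒴.toBispace) proj φ)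
    (hP : (diagAction 𝒳.toBispace 𝒴.toBispace).IsProper)
    (hπ : (diagAction 𝒳.toBispace 𝒴.toBispace).IsOrbitMap proj) {g : G₁}
    {ω : OrbitSpace 𝒳.toBispace 𝒴.toBispace} (h : 𝓖₁.s g = leftMom ω) :
    0 < compositeAdj b φ g ω :=
  hφ.integralOverOrbit_mul_pos (diagAction_isContinuous 𝒳.right_continuous 𝒴.left_continuous) hP hπ
    (fun _ z γ h => h.trans (leftAction_mom_diagAction_totalAct z γ).symm)
    (continuousOn_compositeWeight hb) (fun _ _ => compositeWeight_pos hb)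
    (h.trans (congrArg leftMom (proj_rep ω)).symm)

end CompositeAdjoining


section CompositeCorrespondence

open FibreProd OrbitSpace

variable {G₁ U₁ G₂ U₂ G₃ U₃ X Y : Type*}
  [TopologicalSpace G₁] [TopologicalSpace U₁] [TopologicalSpace G₂] [TopologicalSpace U₂]
  [TopologicalSpace G₃] [TopologicalSpace U₃] [TopologicalSpace X] [TopologicalSpace Y]
  [MeasurableSpace G₁] [MeasurableSpace G₂] [MeasurableSpace G₃]
  [MeasurableSpace X] [MeasurableSpace Y]
  {𝓖₁ : HaarGroupoid G₁ U₁} {𝓖₂ : HaarGroupoid G₂ U₂} {𝓖₃ : HaarGroupoid G₃ U₃}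
  {𝒳 : TopologicalCorrespondence 𝓖₁ 𝓖₂ X} {𝒴 : TopologicalCorrespondence 𝓖₂ 𝓖₃ Y}
  {b φ : FibreProd 𝒳.toBispace 𝒴.toBispace → ℝ}
  {μ μ' : U₃ → Measure (OrbitSpace 𝒳.toBispace 𝒴.toBispace)}

theorem OrbitSpace.bispace_left_totalAct (g : G₁) (ω : OrbitSpace 𝒳.toBispace 𝒴.toBispace) :
    (bispace 𝒳.toBispace 𝒴.toBispace).left.totalAct g ω = leftActAux g ω := by
  by_cases h : 𝓖₁.s g = leftMom ω
  · exact (bispace 𝒳.toBispace 𝒴.toBispace).left.totalAct_eq h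
  · obtain ⟨z, rfl⟩ := proj_surjective ω
    have hz : (leftAction 𝒳.toBispace 𝒴.toBispace).totalAct g z = z := dif_neg h
    rw [← proj_leftAction_totalAct, hz]
    exact dif_neg h

/-- The integrand `F(g, [w]) Δ(g, w) φ(w)`, with `Δ` the weight of the composite and `φ` a cutoff
function, whose orbit integral is the integrand in the adjoining identity of the composite. -/
def adjoiningIntegrand (b φ : FibreProd 𝒳.toBispace 𝒴.toBispace → ℝ)
    (F : G₁ × OrbitSpace 𝒳.toBispace 𝒴.toBispace → ℝ) (g : G₁)
    (w : FibreProd 𝒳.toBispace 𝒴.toBispace) : ℝ :=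
  F (g, proj w) * (compositeWeight b g w * φ w)

theorem mul_ne_zero_of_adjoiningIntegrand_ne_zero
    {F : G₁ × OrbitSpace 𝒳.toBispace 𝒴.toBispace → ℝ} {g : G₁}
    {w : FibreProd 𝒳.toBispace 𝒴.toBispace} (h : adjoiningIntegrand b φ F g w ≠ 0) :
    F (g, proj w) * φ w ≠ 0 :=
  mul_ne_zero (left_ne_zero_of_mul h) (right_ne_zero_of_mul (right_ne_zero_of_mul h))

theorem continuousOn_adjoiningIntegrand (hb : IsCompositeCochain 𝒳 𝒴 b) (hφ : Continuous φ)
    {F : G₁ × OrbitSpace 𝒳.toBispace 𝒴.toBispace → ℝ} (hF : Continuous F) :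
    ContinuousOn (fun a : G₁ × FibreProd 𝒳.toBispace 𝒴.toBispace =>
        adjoiningIntegrand b φ F a.1 a.2)
      {a | 𝓖₁.s a.1 = (leftAction 𝒳.toBispace 𝒴.toBispace).mom a.2} := by
  refine ContinuousOn.mul (Continuous.continuousOn ?_)
    ((continuousOn_compositeWeight hb).mul (hφ.comp continuous_snd).continuousOn)
  exact hF.comp (continuous_fst.prodMk (isQuotientMap_proj.continuous.comp continuous_snd))

theorem adjoiningIntegrand_totalAct_inv_mul (hb : IsCompositeCochain 𝒳 𝒴 b)
    (F : G₁ × OrbitSpace 𝒳.toBispace 𝒴.toBispace → ℝ) {g : G₁}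
    {z : FibreProd 𝒳.toBispace 𝒴.toBispace}
    (hg : 𝓖₁.r g = (leftAction 𝒳.toBispace 𝒴.toBispace).mom z) :
    adjoiningIntegrand b φ F g
        ((leftAction 𝒳.toBispace 𝒴.toBispace).totalAct (𝓖₁.inv g) z) * b z =
      extendByZero (fun w => F (g, proj w) * φ w * b w)
          (𝒳.left.totalAct (𝓖₁.inv g) z.fst) z.snd *
        𝒳.left.extendByZero 𝒳.adj g (𝒳.left.totalAct (𝓖₁.inv g) z.fst) := by
  have hz := (hb.pos z).ne'
  rw [← fst_leftAction_totalAct (B := 𝒴.toBispace),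
    ← snd_leftAction_totalAct (𝓖₁.inv g) z, extendByZero_fst_snd, adjoiningIntegrand,
    compositeWeight, (leftAction 𝒳.toBispace 𝒴.toBispace).totalAct_totalAct_inv hg]
  field_simp

theorem mul_compositeAdj_proj [T2Space G₂] [LocallyCompactSpace G₂]
    (hb : IsCompositeCochain 𝒳 𝒴 b)
    (hφ : IsCutoff 𝓖₂ (diagAction 𝒳.toBispace 𝒴.toBispace) proj φ)
    (hP : (diagAction 𝒳.toBispace 𝒴.toBispace).IsProper)
    (hπ : (diagAction 𝒳.toBispace 𝒴.toBispace).IsOrbitMap proj)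
    (F : G₁ × OrbitSpace 𝒳.toBispace 𝒴.toBispace → ℝ) {g : G₁}
    {w : FibreProd 𝒳.toBispace 𝒴.toBispace}
    (h : 𝓖₁.s g = (leftAction 𝒳.toBispace 𝒴.toBispace).mom w) :
    F (g, proj w) * compositeAdj b φ g (proj w) =
      integralOverOrbit 𝓖₂ (diagAction 𝒳.toBispace 𝒴.toBispace) (adjoiningIntegrand b φ F g) w := by
  rw [compositeAdj_proj hb hφ hP hπ h, integralOverOrbit, integralOverOrbit, ← integral_const_mul]
  simp only [adjoiningIntegrand, hπ.apply_totalAct]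

variable [T2Space G₁] [LocallyCompactSpace G₁]

/- The cutoff function sits at `z` on the left and at `g⁻¹z` on the right, which is harmless after
integrating over the orbits. -/
theorem integral_extendByZero_integral_inv_eq [T2Space X] [LocallyCompactSpace X] [T2Space U₁]
    [T2Space U₂] (hb : IsCompositeCochain 𝒳 𝒴 b) (hφ : Continuous φ)
    {F : G₁ × OrbitSpace 𝒳.toBispace 𝒴.toBispace → ℝ} (hF : Continuous F) {K : Set G₁}
    {C : Set (FibreProd 𝒳.toBispace 𝒴.toBispace)} (hK : IsCompact K) (hC : IsCompact C)
    (hKC : ∀ g w, F (g, proj w) * φ w ≠ 0 → g ∈ K ∧ w ∈ C) (y : Y) :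
    ∫ x, extendByZero
        (fun z => φ z * (∫ g, F (𝓖₁.inv g, proj z) ∂𝓖₁.haar (𝒳.left.mom z.fst)) * b z)
        x y ∂𝒳.lam (𝒴.left.mom y) =
      ∫ x, extendByZero (fun z => (∫ g, adjoiningIntegrand b φ F g
          ((leftAction 𝒳.toBispace 𝒴.toBispace).totalAct (𝓖₁.inv g) z)
            ∂𝓖₁.haar (𝒳.left.mom z.fst)) * b z) x y ∂𝒳.lam (𝒴.left.mom y) := by
  let E : G₁ → FibreProd 𝒳.toBispace 𝒴.toBispace → ℝ := fun g z => F (g, proj z) * φ z * b z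
  have hE : Continuous fun a : G₁ × FibreProd 𝒳.toBispace 𝒴.toBispace => E a.1 a.2 :=
    ((hF.comp (continuous_fst.prodMk (isQuotientMap_proj.continuous.comp continuous_snd))).mul
      (hφ.comp continuous_snd)).mul (hb.continuous.comp continuous_snd)
  have h_adj := 𝒳.adjoining.integral_inv_eq (v := 𝒴.left.mom y)
    (E := fun g x => extendByZero (E g) x y) 𝒳.left_continuous 𝒳.family 𝒳.right_continuous.mom
    𝒳.right_mom_act ((continuousOn_extendByZero_left hE y).mono fun a ha => ha.2) hK
    (hC.image FibreProd.continuous_fst) fun g x hx hEx => by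
      rw [extendByZero_eq _ hx] at hEx
      obtain ⟨hg, hz⟩ := hKC g _ (left_ne_zero_of_mul hEx)
      exact ⟨hg, _, hz, rfl⟩
  refine Eq.trans ?_ (h_adj.trans ?_)
  · refine 𝒳.family.integral_congr fun x hx => ?_
    rw [extendByZero_eq _ hx, mul_right_comm, ← integral_const_mul]
    refine 𝓖₁.haar_family.integral_congr fun g _ => ?_
    rw [extendByZero_eq _ hx]
    ring
  · refine 𝒳.family.integral_congr fun x hx => ?_
    rw [extendByZero_eq _ hx, ← integral_mul_const]
    exact 𝓖₁.haar_family.integral_congr fun g hg =>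
      (adjoiningIntegrand_totalAct_inv_mul (z := ⟨(x, y), hx⟩) hb F hg).symm

variable [BorelSpace G₁] [T2Space G₂] [LocallyCompactSpace G₂] [T2Space U₁] [T2Space U₂]

theorem integral_integral_adjoiningIntegrand_swap [BorelSpace G₂]
    (hb : IsCompositeCochain 𝒳 𝒴 b) (hφ : Continuous φ)
    (hP : (diagAction 𝒳.toBispace 𝒴.toBispace).IsProper)
    {F : G₁ × OrbitSpace 𝒳.toBispace 𝒴.toBispace → ℝ} (hF : Continuous F) {K : Set G₁}
    {C : Set (FibreProd 𝒳.toBispace 𝒴.toBispace)} (hK : IsCompact K) (hC : IsCompact C)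
    (hKC : ∀ g w, F (g, proj w) * φ w ≠ 0 → g ∈ K ∧ w ∈ C)
    (z : FibreProd 𝒳.toBispace 𝒴.toBispace) :
    ∫ γ, ∫ g, adjoiningIntegrand b φ F g ((leftAction 𝒳.toBispace 𝒴.toBispace).totalAct
          (𝓖₁.inv g) ((diagAction 𝒳.toBispace 𝒴.toBispace).totalAct z γ))
        ∂𝓖₁.haar (𝒳.left.mom z.fst) ∂𝓖₂.haar z.mom =
      ∫ g, ∫ γ, adjoiningIntegrand b φ F g ((leftAction 𝒳.toBispace 𝒴.toBispace).totalAct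
          (𝓖₁.inv g) ((diagAction 𝒳.toBispace 𝒴.toBispace).totalAct z γ))
        ∂𝓖₂.haar z.mom ∂𝓖₁.haar (𝒳.left.mom z.fst) := by
  have hL := leftAction_isContinuous (B := 𝒴.toBispace) 𝒳.left_continuous
  have hR := diagAction_isContinuous 𝒳.right_continuous 𝒴.left_continuous
  obtain ⟨M, hM, hM_mem⟩ := hL.exists_isCompact_forall_mem hK hC
  obtain ⟨N, hN, hN_mem⟩ := hP.exists_isCompact_forall_act_mem (isCompact_singleton (x := z)) hM
  refine 𝓖₂.haar_family.integral_swap 𝓖₂.continuous_r 𝓖₁.haar_family 𝓖₁.continuous_r ?_ hN hK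
    fun γ g hγ hg h => ?_
  · refine (hL.continuousOn_comp_totalAct_inv (continuousOn_adjoiningIntegrand hb hφ hF)).comp
      (f := fun a : G₂ × G₁ => ((diagAction 𝒳.toBispace 𝒴.toBispace).totalAct z a.1, a.2))
      (ContinuousOn.prodMk ?_ continuousOn_snd)
      fun a ha => ha.2.trans (leftAction_mom_diagAction_totalAct z a.1).symm
    exact (hR.continuousOn_totalAct_right z).comp continuousOn_fst fun a ha => ha.1
  · obtain ⟨hgK, hzC⟩ := hKC _ _ (mul_ne_zero_of_adjoiningIntegrand_ne_zero h)
    have hγ' : (diagAction 𝒳.toBispace 𝒴.toBispace).mom z = 𝓖₂.r γ := hγ.symm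
    refine ⟨hN_mem z γ hγ' rfl ?_, hgK⟩
    rw [← (diagAction 𝒳.toBispace 𝒴.toBispace).totalAct_eq hγ']
    exact hM_mem g _ (hg.trans (leftAction_mom_diagAction_totalAct z γ).symm) hgK hzC

variable [BorelSpace G₂]

theorem integral_mul_compositeAdj_eq (hb : IsCompositeCochain 𝒳 𝒴 b)
    (hφ : IsCutoff 𝓖₂ (diagAction 𝒳.toBispace 𝒴.toBispace) proj φ)
    (hP : (diagAction 𝒳.toBispace 𝒴.toBispace).IsProper)
    (hπ : (diagAction 𝒳.toBispace 𝒴.toBispace).IsOrbitMap proj)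
    {F : G₁ × OrbitSpace 𝒳.toBispace 𝒴.toBispace → ℝ} (hF : Continuous F) {K : Set G₁}
    {C : Set (FibreProd 𝒳.toBispace 𝒴.toBispace)} (hK : IsCompact K) (hC : IsCompact C)
    (hKC : ∀ g w, F (g, proj w) * φ w ≠ 0 → g ∈ K ∧ w ∈ C)
    (ω : OrbitSpace 𝒳.toBispace 𝒴.toBispace) :
    ∫ g, F (g, leftActAux (𝓖₁.inv g) ω) * compositeAdj b φ g (leftActAux (𝓖₁.inv g) ω)
        ∂𝓖₁.haar ω.leftMom =
      orbitIntegral 𝒳 𝒴 (fun w => ∫ g, adjoiningIntegrand b φ F g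
          ((leftAction 𝒳.toBispace 𝒴.toBispace).totalAct (𝓖₁.inv g) w)
            ∂𝓖₁.haar (𝒳.left.mom w.fst)) ω := by
  rw [orbitIntegral_eq]
  obtain ⟨z, hz⟩ : ∃ z, z = ω.rep := ⟨_, rfl⟩
  obtain rfl : proj z = ω := hz ▸ proj_rep ω
  rw [← hz]
  refine Eq.trans (𝓖₁.haar_family.integral_congr fun g hg => ?_)
    ((integral_integral_adjoiningIntegrand_swap hb hφ.continuous hP hF hK hC hKC z).symm.trans ?_)
  · have hg_inv : 𝓖₁.s (𝓖₁.inv g) = (leftAction 𝒳.toBispace 𝒴.toBispace).mom z :=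
      (𝓖₁.s_inv g).trans hg
    rw [← proj_leftAction_totalAct, mul_compositeAdj_proj hb hφ hP hπ F
      ((leftAction 𝒳.toBispace 𝒴.toBispace).mom_totalAct_inv hg).symm, integralOverOrbit,
      diagAction_mom_leftAction_totalAct]
    refine 𝓖₂.haar_family.integral_congr fun γ hγ => ?_
    rw [leftAction_totalAct_diagAction_totalAct hg_inv hγ.symm]
  · refine 𝓖₂.haar_family.integral_congr fun γ _ => ?_
    exact congrArg (fun u => ∫ g, adjoiningIntegrand b φ F g ((leftAction 𝒳.toBispace
      𝒴.toBispace).totalAct (𝓖₁.inv g) ((diagAction 𝒳.toBispace 𝒴.toBispace).totalAct z γ))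
        ∂𝓖₁.haar u) (leftAction_mom_diagAction_totalAct z γ).symm

namespace IsComposite

variable [T2Space X] [T2Space Y] [LocallyCompactSpace X]
  [T2Space (OrbitSpace 𝒳.toBispace 𝒴.toBispace)]

theorem integral_integral_inv_eq (hμ : IsComposite 𝒳 𝒴 b μ)
    (hφ : IsCutoff 𝓖₂ (diagAction 𝒳.toBispace 𝒴.toBispace) proj φ)
    (hP : (diagAction 𝒳.toBispace 𝒴.toBispace).IsProper)
    (hπ : (diagAction 𝒳.toBispace 𝒴.toBispace).IsOrbitMap proj) (u : U₃)
    (F : C_c(G₁ × OrbitSpace 𝒳.toBispace 𝒴.toBispace, ℝ)) :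
    ∫ ω, ∫ g, F (𝓖₁.inv g, ω) ∂𝓖₁.haar ω.leftMom ∂μ u =
      ∫ ω, ∫ g, F (g, leftActAux (𝓖₁.inv g) ω) * compositeAdj b φ g (leftActAux (𝓖₁.inv g) ω)
        ∂𝓖₁.haar ω.leftMom ∂μ u := by
  obtain ⟨f, hf⟩ := (bispace_left_isContinuous hπ.isOpenQuotientMap
    𝒳.left_continuous).exists_compactlySupported_integral_inv F
  obtain ⟨K, C, hK, hC, hKC⟩ := hφ.exists_isCompact_forall_mem F
  obtain ⟨H, hH⟩ := (leftAction_isContinuous (B := 𝒴.toBispace)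
    𝒳.left_continuous).exists_compactlySupported_integral_totalAct_inv
      (continuousOn_adjoiningIntegrand hμ.cochain hφ.continuous F.continuous) hK hC
      fun g w h => hKC g w (mul_ne_zero_of_adjoiningIntegrand_ne_zero h)
  calc _ = ∫ ω, f ω ∂μ u := by
        congr 1 with ω
        exact (hf ω).symm
    _ = fibreProdIntegral 𝒳 𝒴 u (hμ.weightedLift hφ f) := hμ.integral_eq hφ hπ f u
    _ = fibreProdIntegral 𝒳 𝒴 u fun z => H z * b z := by
        have h_lift : ⇑(hμ.weightedLift hφ f) = fun z =>
            φ z * (∫ g, F (𝓖₁.inv g, proj z) ∂𝓖₁.haar (𝒳.left.mom z.fst)) * b z :=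
          funext fun z => congrArg (fun t => φ z * t * b z) (hf (proj z))
        rw [fibreProdIntegral_eq, fibreProdIntegral_eq, h_lift, funext hH]
        congr 1 with y
        exact integral_extendByZero_integral_inv_eq hμ.cochain hφ.continuous F.continuous hK hC
          hKC y
    _ = ∫ ω, orbitIntegral 𝒳 𝒴 H ω ∂μ u := (hμ.lift u H).symm
    _ = _ := by
        congr 1 with ω
        exact (congrArg (orbitIntegral 𝒳 𝒴 · ω) (funext hH)).trans
          (integral_mul_compositeAdj_eq hμ.cochain hφ hP hπ F.continuous hK hC hKC ω).symm

variable [LocallyCompactSpace (OrbitSpace 𝒳.toBispace 𝒴.toBispace)]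
  [LocallyCompactSpace (FibreProd 𝒳.toBispace 𝒴.toBispace)]

theorem isAdjoining (hμ : IsComposite 𝒳 𝒴 b μ)
    (hφ : IsCutoff 𝓖₂ (diagAction 𝒳.toBispace 𝒴.toBispace) proj φ)
    (hP : (diagAction 𝒳.toBispace 𝒴.toBispace).IsProper)
    (hπ : (diagAction 𝒳.toBispace 𝒴.toBispace).IsOrbitMap proj) :
    IsAdjoining 𝓖₁ (bispace 𝒳.toBispace 𝒴.toBispace).left μ
      fun p => compositeAdj b φ p.1.1 p.1.2 := by
  refine IsAdjoining.of_integral_eq (bispace_left_isContinuous hπ.isOpenQuotientMap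
    𝒳.left_continuous) (continuousOn_compositeAdj hμ.cochain hφ hP hπ)
    (fun _ _ => compositeAdj_pos hμ.cochain hφ hP hπ) fun u F => ?_
  simp only [bispace_left_totalAct]
  exact hμ.integral_integral_inv_eq hφ hP hπ u F

variable [BorelSpace X] [LocallyCompactSpace Y] [T2Space U₃]

/-- The topological correspondence `(Ω, μ)` defined by a composite family `μ`, for the adjoining
function obtained from the cutoff function `φ`. -/
def toTopologicalCorrespondence (hμ : IsComposite 𝒳 𝒴 b μ)
    (hφ : IsCutoff 𝓖₂ (diagAction 𝒳.toBispace 𝒴.toBispace) proj φ) :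
    TopologicalCorrespondence 𝓖₁ 𝓖₃ (OrbitSpace 𝒳.toBispace 𝒴.toBispace) :=
  have hπ := isOrbitMap_proj 𝓖₂.isOpenMap_r 𝒳.right_continuous 𝒴.left_continuous
  { toBispace := bispace 𝒳.toBispace 𝒴.toBispace
    t2 := inferInstance
    locallyCompact := inferInstance
    left_continuous := bispace_left_isContinuous hπ.isOpenQuotientMap 𝒳.left_continuous
    right_continuous := bispace_right_isContinuous hπ.isOpenQuotientMap 𝒴.right_continuous
    right_proper := bispace_right_isProper 𝓖₂.isOpenMap_r 𝒳.right_continuous 𝒴.left_continuous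
      𝒴.right_continuous 𝒳.right_proper 𝒴.right_proper
    lam := μ
    family := hμ.isContinuousFamily hφ hπ
    invariant := hμ.isInvariantFamily hφ hπ
    adj := fun p => compositeAdj b φ p.1.1 p.1.2
    adjoining := hμ.isAdjoining hφ (diagAction_isProper 𝒳.right_continuous 𝒴.left_continuous
      𝒳.right_proper) hπ }

theorem isCorrIso_refl {b' : FibreProd 𝒳.toBispace 𝒴.toBispace → ℝ}
    (hμ : IsComposite 𝒳 𝒴 b μ) (hμ' : IsComposite 𝒳 𝒴 b' μ')
    (hφ : IsCutoff 𝓖₂ (diagAction 𝒳.toBispace 𝒴.toBispace) proj φ) :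
    IsCorrIso (hμ.toTopologicalCorrespondence hφ) (hμ'.toTopologicalCorrespondence hφ)
      (Homeomorph.refl (OrbitSpace 𝒳.toBispace 𝒴.toBispace)) := by
  refine ⟨fun _ => rfl, fun _ => rfl, fun _ _ _ => rfl, fun _ _ _ => rfl, ?_⟩
  have h_map : (fun u => ((hμ.toTopologicalCorrespondence hφ).lam u).map
      (Homeomorph.refl (OrbitSpace 𝒳.toBispace 𝒴.toBispace))) = μ := funext fun _ => Measure.map_id
  rw [h_map]
  exact hμ.equivalentFamilies hμ' hφ
    (isOrbitMap_proj 𝓖₂.isOpenMap_r 𝒳.right_continuous 𝒴.left_continuous)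

end IsComposite

end CompositeCorrespondence

end

theorem mainTheorem3
    {G₁ U₁ G₂ U₂ G₃ U₃ X Y : Type*}
    [TopologicalSpace G₁] [T2Space G₁] [LocallyCompactSpace G₁]
    [MeasurableSpace G₁] [BorelSpace G₁]
    [TopologicalSpace G₂] [T2Space G₂] [LocallyCompactSpace G₂]
    [MeasurableSpace G₂] [BorelSpace G₂]
    [TopologicalSpace G₃] [T2Space G₃] [LocallyCompactSpace G₃]
    [MeasurableSpace G₃] [BorelSpace G₃]
    [TopologicalSpace U₁] [TopologicalSpace U₂] [TopologicalSpace U₃]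
    [TopologicalSpace X] [MeasurableSpace X] [BorelSpace X]
    [TopologicalSpace Y] [MeasurableSpace Y] [BorelSpace Y]
    (𝓖₁ : HaarGroupoid G₁ U₁) (𝓖₂ : HaarGroupoid G₂ U₂) (𝓖₃ : HaarGroupoid G₃ U₃)
    (𝒳 : TopologicalCorrespondence 𝓖₁ 𝓖₂ X) (𝒴 : TopologicalCorrespondence 𝓖₂ 𝓖₃ Y)
    [ParacompactSpace (OrbitSpace 𝒳.toBispace 𝒴.toBispace)]
    (b b' : FibreProd 𝒳.toBispace 𝒴.toBispace → ℝ)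
    (μ μ' : U₃ → Measure (OrbitSpace 𝒳.toBispace 𝒴.toBispace))
    (hμ : IsComposite 𝒳 𝒴 b μ) (hμ' : IsComposite 𝒳 𝒴 b' μ') :
    (∃ M M' : TopologicalCorrespondence 𝓖₁ 𝓖₃ (OrbitSpace 𝒳.toBispace 𝒴.toBispace),
      M.toBispace = OrbitSpace.bispace 𝒳.toBispace 𝒴.toBispace ∧ M.lam = μ ∧
      M'.toBispace = OrbitSpace.bispace 𝒳.toBispace 𝒴.toBispace ∧ M'.lam = μ' ∧
      IsCorrIso M M' (Homeomorph.refl (OrbitSpace 𝒳.toBispace 𝒴.toBispace))) ∧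
    (∃! c : OrbitSpace 𝒳.toBispace 𝒴.toBispace → ℝ, ∀ z, b' z = c (OrbitSpace.proj z) * b z) ∧
    (∀ c : OrbitSpace 𝒳.toBispace 𝒴.toBispace → ℝ,
      (∀ z, b' z = c (OrbitSpace.proj z) * b z) →
        Continuous c ∧ (∀ ω, 0 < c ω) ∧ IsRNDeriv μ' μ c) := by
  have := 𝒳.t2
  have := 𝒴.t2
  have := 𝒳.locallyCompact
  have := 𝒴.locallyCompact
  have := 𝓖₁.t2Space_units
  have := 𝓖₂.t2Space_units
  have := 𝓖₃.t2Space_units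
  have := FibreProd.locallyCompactSpace 𝒳.right_continuous 𝒴.left_continuous
  have hP := FibreProd.diagAction_isProper 𝒳.right_continuous 𝒴.left_continuous 𝒳.right_proper
  have hπ := OrbitSpace.isOrbitMap_proj 𝓖₂.isOpenMap_r 𝒳.right_continuous 𝒴.left_continuous
  have := hπ.t2Space hP
  have := hπ.isOpenQuotientMap.locallyCompactSpace
  obtain ⟨φ, hφ⟩ := exists_isCutoff (𝓗 := 𝓖₂)
    (FibreProd.diagAction_isContinuous 𝒳.right_continuous 𝒴.left_continuous) hP hπ
  exact ⟨⟨hμ.toTopologicalCorrespondence hφ, hμ'.toTopologicalCorrespondence hφ, rfl, rfl, rfl,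
      rfl, hμ.isCorrIso_refl hμ' hφ⟩,
    hμ.cochain.existsUnique_eq_mul hμ'.cochain,
    fun c hc => ⟨hμ.cochain.continuous_of_eq_mul hμ'.cochain hc,
      hμ.cochain.pos_of_eq_mul hμ'.cochain hc, hμ.isRNDeriv hμ' hφ hπ hc⟩⟩
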